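/- Let $S\ge 0$ be a random variable with $0<\mathbb{E}S<\infty$, let $\lambda>0$, and suppose that $\rho:=\lambda\,\mathbb{E}S<1$. Consider an M/G/1 queue (a single server serving in order of arrival) in which customers arrive according to a Poisson process of rate $\lambda$ and the service times are i.i.d. copies of $S$, independent of the arrivals. Suppose that the queue is in equilibrium, that is, the state (number of customers in the system, residual service time of the customer in service) has the same law at all times, and let $W$ be the number of customers in the system, counting the one in service. Suppose that $S$ is new better than used in expectation (NBUE), i.e. $\mathbb{E}[S-t\mid S\ge t]\le \mathbb{E}S$ for all $t\ge 0$ with $\mathbb{P}(S\ge t)>0$. Then $\mathbb{E}[S^2]<\infty$ and $$ d_{TV}\bigl(\mathcal{L}(W),\mathrm{Geom}(1-\rho)\bigr)\le \rho^2\left(1-\frac{\mathbb{E}[S^2]}{2(\mathbb{E}S)^2}\right), $$ where $\mathrm{Geom}(p)$ is the law on $\{0,1,2,\ldots\}$ with mass $p(1-p)^k$ at $k$, and $d_{TV}(\mu,\nu)=\sup_{A\subseteq\{0,1,2,\ldots\}}|\mu(A)-\nu(A)|$. -/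

import Mathlib

open MeasureTheory ProbabilityTheory

noncomputable section

/-- Total variation distance `sup_{A ⊆ ℕ} |μ(A) - ν(A)|` between probability laws on `ℕ`. -/
def tvDist (μ ν : Measure ℕ) : ℝ := ⨆ A : Set ℕ, |μ.real A - ν.real A|

/-- `S` is new better than used in expectation: `E[S - t | S ≥ t] ≤ E S` for every `t ≥ 0` for
which the conditioning event has positive probability. -/
def IsNBUE {Ω : Type*} [MeasurableSpace Ω] (P : Measure Ω) (S : Ω → ℝ) : Prop :=
  ∀ t : ℝ, 0 ≤ t → P {ω | t ≤ S ω} ≠ 0 →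
    ∫ ω, (S ω - t) ∂(ProbabilityTheory.cond P {ω | t ≤ S ω}) ≤ ∫ ω, S ω ∂P

namespace SingleServer

/-! Sample paths of a single-server, first-come-first-served queue on the time axis `[0, ∞)`.
At time `0` there are `n₀` customers in the system; if `n₀ ≥ 1`, the one in service has residual
service time `r₀`. `T k` is the `k`-th interarrival time after time `0` and `V i` is the service
time of customer `i`. The customers are numbered `0, 1, 2, …` in the order in which they are
served: customers `0, …, n₀ - 1` are those present at time `0` (customer `0` being in service),
and customers `n₀, n₀ + 1, …` arrive at the times `T 0`, `T 0 + T 1`, …. -/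

/-- Arrival time of customer `i` (set to `0` for those already present at time `0`). -/
def arrival (n₀ : ℕ) (T : ℕ → ℝ) (i : ℕ) : ℝ :=
  if i < n₀ then 0 else ∑ k ∈ Finset.range (i - n₀ + 1), T k

/-- Amount of service that customer `i` requires from time `0` on: the residual service time for
the customer in service at time `0`, and the full service time for all the others. -/
def requirement (n₀ : ℕ) (r₀ : ℝ) (V : ℕ → ℝ) (i : ℕ) : ℝ :=
  if i = 0 ∧ 0 < n₀ then r₀ else V i

/-- Departure time of customer `i`: the service of a customer begins as soon as that customer has
arrived and the preceding one has left. -/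
def departure (n₀ : ℕ) (r₀ : ℝ) (T V : ℕ → ℝ) : ℕ → ℝ
  | 0 => arrival n₀ T 0 + requirement n₀ r₀ V 0
  | i + 1 => max (arrival n₀ T (i + 1)) (departure n₀ r₀ T V i) + requirement n₀ r₀ V (i + 1)

/-- The customers who are in the system (waiting or in service) at time `t`. -/
def present (n₀ : ℕ) (r₀ : ℝ) (T V : ℕ → ℝ) (t : ℝ) : Set ℕ :=
  {i | arrival n₀ T i ≤ t ∧ t < departure n₀ r₀ T V i}

/-- The number of customers in the system at time `t`. -/
def number (n₀ : ℕ) (r₀ : ℝ) (T V : ℕ → ℝ) (t : ℝ) : ℕ :=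
  (present n₀ r₀ T V t).ncard

/-- The residual service time at time `t` of the customer in service, who is the first of those
present; it is `0` if the system is empty. -/
def residual (n₀ : ℕ) (r₀ : ℝ) (T V : ℕ → ℝ) (t : ℝ) : ℝ :=
  if number n₀ r₀ T V t = 0 then 0
  else departure n₀ r₀ T V (sInf (present n₀ r₀ T V t)) - t

end SingleServer

/-- An M/G/1 queue, on the time axis `[0, ∞)`, with arrival rate `lam`, service times distributed
as `S`, interarrival times `T k`, service times `V i`, and initial state `(N₀, R₀)` (number of
customers, residual service time of the one in service), where `R₀ = 0` if the system is empty. -/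
structure IsMG1Queue {Ω : Type*} [MeasurableSpace Ω] (P : Measure Ω) (lam : ℝ) (S : Ω → ℝ)
    (T V : ℕ → Ω → ℝ) (N₀ : Ω → ℕ) (R₀ : Ω → ℝ) : Prop where
  measurable_interarrival : ∀ k, Measurable (T k)
  measurable_service : ∀ i, Measurable (V i)
  measurable_number : Measurable N₀
  measurable_residual : Measurable R₀
  /-- The arrivals form a Poisson process of rate `lam`. -/
  interarrival_law : ∀ k, P.map (T k) = expMeasure lam
  interarrival_indep : iIndepFun T P
  /-- The service times are i.i.d. copies of `S`. -/
  service_law : ∀ i, IdentDistrib (V i) S P P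
  service_indep : iIndepFun V P
  /-- Interarrival times, service times and the initial state are independent. -/
  indep_arrival_service : IndepFun (fun ω k => T k ω) (fun ω i => V i ω) P
  indep_initial :
    IndepFun (fun ω => (N₀ ω, R₀ ω)) (fun ω => ((fun k => T k ω), (fun i => V i ω))) P
  residual_pos : ∀ᵐ ω ∂P, N₀ ω ≠ 0 → 0 < R₀ ω
  residual_empty : ∀ᵐ ω ∂P, N₀ ω = 0 → R₀ ω = 0

/-- The number of customers in the system at time `t`, as a random variable. -/
def queueLength {Ω : Type*} (T V : ℕ → Ω → ℝ) (N₀ : Ω → ℕ) (R₀ : Ω → ℝ) (t : ℝ) (ω : Ω) : ℕ :=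
  SingleServer.number (N₀ ω) (R₀ ω) (fun k => T k ω) (fun i => V i ω) t

/-- The residual service time at time `t` of the customer in service, as a random variable. -/
def residualService {Ω : Type*} (T V : ℕ → Ω → ℝ) (N₀ : Ω → ℕ) (R₀ : Ω → ℝ) (t : ℝ) (ω : Ω) : ℝ :=
  SingleServer.residual (N₀ ω) (R₀ ω) (fun k => T k ω) (fun i => V i ω) t

/-- The queue is in equilibrium: its Markovian state (number of customers in the system, residual
service time of the customer in service) has the same law at all times `t ≥ 0`. -/
def InEquilibrium {Ω : Type*} [MeasurableSpace Ω] (P : Measure Ω)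
    (T V : ℕ → Ω → ℝ) (N₀ : Ω → ℕ) (R₀ : Ω → ℝ) : Prop :=
  ∀ t : ℝ, 0 ≤ t →
    IdentDistrib (fun ω => (queueLength T V N₀ R₀ t ω, residualService T V N₀ R₀ t ω))
      (fun ω => (N₀ ω, R₀ ω)) P P

end

/-! Comparing the state of the equilibrium queue at times `0` and `h`, as `h → 0`, gives a balance
equation for functions `z ^ n * φ r` of the state (`IsMG1Queue.balance`). If `E φ(S) = z φ(0)`,
service completions contribute nothing to it; if moreover `φ' + λ(1 - z)φ = -1`, it involves only `E
z^W` and `P(W = 0)`. An exponential `φ` meets both conditions and yields the Pollaczek–Khinchine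
formula (`IsMG1Queue.pollaczek_khinchine`).

Let `W` and `A` now denote the generating functions of the queue length and of the number `a` of
arrivals during one service, a Poisson mixture over `λS` with mean `ρ`. Let `B` be that of the
equilibrium law of `a`, with masses `P(a > n)/ρ`. Since `1 - A = ρ(1 - X)B`, the formula reads `W =
QA` with `Q = (1 - ρ)/(1 - ρB)`, the law of a geometric sum. Comparison with `G = (1 - ρ)/(1 - ρX)`
gives `W - G = ρ X Q D (1 - X G)`, where `D = (B - A)/(1 - X)` has the differences of the tails of
`a` and of its equilibrium law as coefficients (`sub_geometric_of_pollaczek_khinchine`).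

By Tonelli, NBUE passes from `S` to the Poisson mixture (`integral_poissonTail₂_le`), and there it
says that `D` has nonnegative coefficients. As `X`, `Q` and `G` have mass `1`, `W - G` is `ρ` times
a difference of two nonnegative sequences, each of mass `D(1) = ρ - E(λS)²/(2ρ)`. The total
variation distance is therefore at most `ρ D(1)`, which is the claimed bound
(`tvDist_le_of_sub_eq`). The same Tonelli argument with a constant kernel gives the second moment.
-/

noncomputable section

open Filter Topology

/-! ### Sample paths over a short time interval -/

namespace SingleServer

variable {n₀ : ℕ} {r₀ h : ℝ} {T V : ℕ → ℝ}

lemma arrival_of_lt {i : ℕ} (hi : i < n₀) : arrival n₀ T i = 0 := if_pos hi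

lemma arrival_self : arrival n₀ T n₀ = T 0 := by simp [arrival]

lemma sum_range_le_arrival (hT : ∀ k, 0 < T k) {i j : ℕ} (hi : n₀ + j ≤ i) :
    ∑ k ∈ Finset.range (j + 1), T k ≤ arrival n₀ T i := by
  rw [arrival, if_neg (by omega)]
  exact Finset.sum_le_sum_of_subset_of_nonneg (Finset.range_mono (by omega))
    fun k _ _ => (hT k).le

lemma departure_zero_of_pos (hn : 0 < n₀) : departure n₀ r₀ T V 0 = r₀ := by
  simp [departure, arrival, requirement, hn]

lemma departure_mono (hV : ∀ i, 0 ≤ V i) : Monotone (departure n₀ r₀ T V) := by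
  refine monotone_nat_of_le_succ fun i => ?_
  have : requirement n₀ r₀ V (i + 1) = V (i + 1) := by simp [requirement]
  rw [departure, this]
  exact (le_max_right _ _).trans (le_add_of_nonneg_right (hV _))

lemma arrival_le_departure (hV : ∀ i, 0 ≤ V i) (hr : 0 ≤ r₀) (i : ℕ) :
    arrival n₀ T i ≤ departure n₀ r₀ T V i := by
  have hreq : ∀ i, 0 ≤ requirement n₀ r₀ V i := fun i => by
    unfold requirement; split_ifs
    exacts [hr, hV i]
  cases i with
  | zero => exact le_add_of_nonneg_right (hreq 0)
  | succ i => exact (le_max_left _ _).trans (le_add_of_nonneg_right (hreq _))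

/-- Service in order of arrival makes the departure times monotone, so the customers present have
consecutive indices: `a` is the first not yet departed and `b` the first not yet arrived. The number
in system and the residual service are then read off the endpoints. -/
lemma present_eq_Ico (hV : ∀ i, 0 ≤ V i) {a b : ℕ}
    (hb : ∀ i < b, arrival n₀ T i ≤ h) (hb' : ∀ i, b ≤ i → h < arrival n₀ T i)
    (ha : ∀ i < a, departure n₀ r₀ T V i ≤ h) (ha' : h < departure n₀ r₀ T V a) :
    present n₀ r₀ T V h = Set.Ico a b := by
  ext i
  simp only [present, Set.mem_ofPred_eq, Set.mem_Ico]
  constructor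
  · rintro ⟨h1, h2⟩
    constructor
    · by_contra! hlt
      exact (ha i hlt).not_gt h2
    · by_contra! hle
      exact (hb' i hle).not_ge h1
  · rintro ⟨h1, h2⟩
    exact ⟨hb i h2, ha'.trans_le (departure_mono hV h1)⟩

lemma number_of_present {a b : ℕ} (hp : present n₀ r₀ T V h = Set.Ico a b) :
    number n₀ r₀ T V h = b - a := by
  rw [number, hp, ← Finset.coe_Ico, Set.ncard_coe_finset, Nat.card_Ico]

lemma residual_of_present {a b : ℕ} (hab : a < b) (hp : present n₀ r₀ T V h = Set.Ico a b) :
    residual n₀ r₀ T V h = departure n₀ r₀ T V a - h := by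
  have hmin : sInf (Set.Ico a b) = a :=
    le_antisymm (Nat.sInf_le ⟨le_rfl, hab⟩)
      (Nat.sInf_mem (⟨a, le_rfl, hab⟩ : (Set.Ico a b).Nonempty)).1
  rw [residual, number_of_present hp, if_neg (by omega), hp, hmin]

/-- The state of an empty system remains unchanged until the first arrival. -/
lemma number_of_empty_of_lt (hT : ∀ k, 0 < T k) (hV : ∀ i, 0 ≤ V i) (h0 : h < T 0)
    (hr : 0 ≤ r₀) : number 0 r₀ T V h = 0 := by
  have hlt : ∀ i, 0 ≤ i → h < arrival 0 T i := fun i hi =>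
    h0.trans_le (by simpa using sum_range_le_arrival hT (n₀ := 0) (j := 0) (i := i) (by omega))
  simpa using number_of_present (a := 0) (b := 0) (n₀ := 0) (r₀ := r₀) (h := h) (T := T) (V := V)
    (present_eq_Ico hV (by simp) hlt (by simp)
      ((hlt 0 le_rfl).trans_le (arrival_le_departure hV hr 0)))

/-- If there is no arrival and no departure, then the residual service time decreases at unit
speed. -/
lemma state_of_lt_residual (hT : ∀ k, 0 < T k) (hV : ∀ i, 0 ≤ V i) (hh : 0 ≤ h) (h0 : h < T 0)
    (hn : 0 < n₀) (hr : h < r₀) :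
    number n₀ r₀ T V h = n₀ ∧ residual n₀ r₀ T V h = r₀ - h := by
  have hp : present n₀ r₀ T V h = Set.Ico 0 n₀ :=
    present_eq_Ico hV (fun i hi => by rwa [arrival_of_lt hi])
      (fun i hi => h0.trans_le (by simpa using sum_range_le_arrival hT (j := 0) (by omega)))
      (by simp) (by rwa [departure_zero_of_pos hn])
  refine ⟨by simpa using number_of_present hp, ?_⟩
  rw [residual_of_present hn hp, departure_zero_of_pos hn]

/-- A single customer whose service is finished before the first arrival leaves the system
empty. -/
lemma number_of_last_departure (hT : ∀ k, 0 < T k) (hV : ∀ i, 0 ≤ V i) (hr0 : 0 ≤ r₀)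
    (h0 : h < T 0) (hh : 0 ≤ h) (hr : r₀ ≤ h) : number 1 r₀ T V h = 0 := by
  have hlt : ∀ i, 1 ≤ i → h < arrival 1 T i := fun i hi =>
    h0.trans_le (by simpa using sum_range_le_arrival hT (n₀ := 1) (j := 0) (i := i) (by omega))
  have hp : present 1 r₀ T V h = Set.Ico 1 1 := by
    refine present_eq_Ico hV (fun i hi => by rwa [arrival_of_lt hi]) hlt (fun i hi => ?_)
      ((hlt 1 le_rfl).trans_le (arrival_le_departure hV hr0 1))
    obtain rfl : i = 0 := by omega
    rwa [departure_zero_of_pos one_pos]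
  simpa using number_of_present hp

/-- If the first service is finished, the second is not, and there is no arrival, then one
customer has left. -/
lemma state_of_residual_le (hT : ∀ k, 0 < T k) (hV : ∀ i, 0 ≤ V i) (hr0 : 0 < r₀) (hh : 0 ≤ h)
    (h0 : h < T 0) (hn : 2 ≤ n₀) (hr : r₀ ≤ h) (hV1 : h ≤ V 1) :
    number n₀ r₀ T V h = n₀ - 1 ∧ residual n₀ r₀ T V h = r₀ + V 1 - h := by
  have hd : departure n₀ r₀ T V 1 = r₀ + V 1 := by
    rw [departure, arrival_of_lt (by omega), departure_zero_of_pos (by omega), max_eq_right hr0.le]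
    simp [requirement]
  have hp : present n₀ r₀ T V h = Set.Ico 1 n₀ := by
    refine present_eq_Ico hV (fun i hi => by rwa [arrival_of_lt hi])
      (fun i hi => h0.trans_le (by simpa using sum_range_le_arrival hT (j := 0) (by omega)))
      (fun i hi => ?_) (by rw [hd]; linarith)
    obtain rfl : i = 0 := by omega
    rwa [departure_zero_of_pos (by omega)]
  refine ⟨by simpa using number_of_present hp, ?_⟩
  rw [residual_of_present (by omega) hp, hd]

/-- The first customer to arrive at an empty system enters service at once. -/
lemma state_of_empty_of_le (hT : ∀ k, 0 < T k) (hV : ∀ i, 0 ≤ V i) (h0 : T 0 ≤ h)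
    (h1 : h < T 0 + T 1) (hV0 : h ≤ V 0) :
    number 0 r₀ T V h = 1 ∧ residual 0 r₀ T V h = T 0 + V 0 - h := by
  have hd : departure 0 r₀ T V 0 = T 0 + V 0 := by
    simp [departure, arrival, requirement]
  have hp : present 0 r₀ T V h = Set.Ico 0 1 := by
    refine present_eq_Ico hV (fun i hi => ?_) (fun i hi => h1.trans_le ?_) (by simp) ?_
    · obtain rfl : i = 0 := by omega
      rwa [arrival_self]
    · simpa [Finset.sum_range_succ] using
        sum_range_le_arrival hT (n₀ := 0) (j := 1) (i := i) (by omega)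
    · rw [hd]; linarith [hT 0]
  refine ⟨by simpa using number_of_present hp, ?_⟩
  rw [residual_of_present one_pos hp, hd]

/-- A customer who arrives during the first service joins the queue. -/
lemma state_of_lt_residual_of_le (hT : ∀ k, 0 < T k) (hV : ∀ i, 0 ≤ V i) (h0 : T 0 ≤ h)
    (h1 : h < T 0 + T 1) (hn : 0 < n₀) (hr : h < r₀) :
    number n₀ r₀ T V h = n₀ + 1 ∧ residual n₀ r₀ T V h = r₀ - h := by
  have hp : present n₀ r₀ T V h = Set.Ico 0 (n₀ + 1) := by
    refine present_eq_Ico hV (fun i hi => ?_) (fun i hi => h1.trans_le ?_) (by simp)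
      (by rwa [departure_zero_of_pos hn])
    · rcases (Nat.lt_succ_iff_lt_or_eq.1 hi) with hi | rfl
      · rw [arrival_of_lt hi]; exact (hT 0).le.trans h0
      · rwa [arrival_self]
    · simpa [Finset.sum_range_succ] using sum_range_le_arrival hT (j := 1) (by omega)
  refine ⟨by simpa using number_of_present hp, ?_⟩
  rw [residual_of_present (by omega) hp, departure_zero_of_pos hn]

end SingleServer

/-! ### Pathwise first-order expansion of the test functions -/

namespace SingleServer

/-- The function `(n, r) ↦ zⁿ φ(r)` of the state of the queue, with the value at the empty state
that is the limit of its values before the last departure. -/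
def stateFn (z : ℝ) (φ : ℝ → ℝ) (x : ℕ × ℝ) : ℝ := if x.1 = 0 then z * φ 0 else z ^ x.1 * φ x.2

/-- The first-order change of `stateFn z φ` in a time interval of length `h`. -/
def increment (z : ℝ) (φ ψ : ℝ → ℝ) (h : ℝ) (x : ℕ × ℝ) (t₀ v₀ v₁ : ℝ) : ℝ :=
  (-h) * (if 0 < x.1 ∧ h < x.2 then z ^ x.1 * ψ x.2 else 0)
    - (1 - z) * ((if 0 < x.1 ∧ h < x.2 then z ^ x.1 * φ x.2 else 0) * (if t₀ ≤ h then 1 else 0))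
    + z * ((if x.1 = 0 then 1 else 0) * ((if t₀ ≤ h then 1 else 0) * (φ v₀ - φ 0)))
    + (if 2 ≤ x.1 ∧ x.2 ≤ h then z ^ (x.1 - 1) else 0) * (φ v₁ - z * φ 0)

/-- A bound, up to a constant factor, for the error of `increment`. -/
def incrementError (h : ℝ) (x : ℕ × ℝ) (t₀ t₁ v₀ v₁ : ℝ) : ℝ :=
  h ^ 2 + h * (if t₀ ≤ h then 1 else 0)
    + (if t₀ ≤ h then 1 else 0) * (if t₁ ≤ h then 1 else 0)
    + (if t₀ ≤ h then 1 else 0) * (if v₀ < h then 1 else 0)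
    + (if 0 < x.1 ∧ x.2 ≤ h then 1 else 0)
      * (h + (if t₀ ≤ h then 1 else 0) + (if v₁ < h then 1 else 0))

variable {n₀ : ℕ} {r₀ h z K : ℝ} {T V : ℕ → ℝ} {φ ψ : ℝ → ℝ}

lemma abs_stateFn_le (hz0 : 0 ≤ z) (hz1 : z ≤ 1) (hφ : ∀ x, |φ x| ≤ K) (x : ℕ × ℝ) :
    |stateFn z φ x| ≤ K := by
  have hK : 0 ≤ K := (abs_nonneg _).trans (hφ 0)
  unfold stateFn
  split_ifs
  · rw [abs_mul, abs_of_nonneg hz0]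
    exact (mul_le_of_le_one_left (abs_nonneg _) hz1).trans (hφ 0)
  · rw [abs_mul, abs_of_nonneg (pow_nonneg hz0 _)]
    exact (mul_le_of_le_one_left (abs_nonneg _) (pow_le_one₀ hz0 hz1)).trans (hφ _)

lemma abs_mul_le_of_le_one {a b c : ℝ} (ha : 0 ≤ a) (ha' : a ≤ 1) (hb : |b| ≤ c) :
    |a * b| ≤ c := by
  rw [abs_mul, abs_of_nonneg ha]
  exact (mul_le_of_le_one_left (abs_nonneg _) ha').trans hb

/-- If the queue is empty at time `0`. -/
lemma abs_stateFn_sub_le_of_empty (hT : ∀ k, 0 < T k) (hV : ∀ i, 0 ≤ V i)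
    (hz0 : 0 ≤ z) (hz1 : z ≤ 1) (hh : 0 < h)
    (hφ : ∀ x, |φ x| ≤ K) (hφ' : ∀ x y, |φ x - φ y| ≤ K * |x - y|) :
    |stateFn z φ (number 0 0 T V h, residual 0 0 T V h) - stateFn z φ (0, 0)
      - increment z φ ψ h (0, 0) (T 0) (V 0) (V 1)|
      ≤ 4 * K * incrementError h (0, 0) (T 0) (T 1) (V 0) (V 1) := by
  have hK : 0 ≤ K := (abs_nonneg _).trans (hφ 0)
  by_cases h0 : h < T 0
  · simp only [stateFn, number_of_empty_of_lt hT hV h0 le_rfl, increment, incrementError,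
      h0.not_ge]
    simp
    positivity
  push Not at h0
  by_cases h1 : h < T 0 + T 1 ∧ h ≤ V 0
  · obtain ⟨e1, e2⟩ := state_of_empty_of_le (r₀ := 0) hT hV h0 h1.1 h1.2
    have key : |z * (φ (T 0 + V 0 - h) - φ (V 0))| ≤ K * h := by
      refine abs_mul_le_of_le_one hz0 hz1 ((hφ' _ _).trans ?_)
      gcongr
      rw [abs_le]
      constructor <;> linarith [hT 0]
    -- The increment ignores the service given since the arrival, which is at most `h`; the term `h
    -- * 1{T 0 ≤ h}` of the error pays for this.
    have herr : h ≤ incrementError h (0, 0) (T 0) (T 1) (V 0) (V 1) := by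
      simp only [incrementError, h0, h1.2.not_gt]
      simp only [if_true, if_false, lt_irrefl, false_and]
      split_ifs <;> nlinarith [sq_nonneg h]
    calc _ = |z * (φ (T 0 + V 0 - h) - φ (V 0))| := by
            congr 1
            simp [stateFn, e1, e2, increment, h0]
            ring
      _ ≤ K * h := key
      _ ≤ 4 * K * incrementError h (0, 0) (T 0) (T 1) (V 0) (V 1) := by nlinarith
  · have herr : 1 ≤ incrementError h (0, 0) (T 0) (T 1) (V 0) (V 1) := by
      have : T 1 ≤ h ∨ V 0 < h := by
        by_contra! hc
        exact h1 ⟨by linarith [hT 0, hc.1], hc.2⟩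
      simp only [incrementError, h0]
      simp only [if_true, lt_irrefl, false_and, if_false]
      rcases this with h' | h' <;> simp only [h', if_true] <;> split_ifs <;>
        nlinarith [sq_nonneg h]
    have hY : |increment z φ ψ h (0, 0) (T 0) (V 0) (V 1)| ≤ 2 * K := by
      have : increment z φ ψ h (0, 0) (T 0) (V 0) (V 1) = z * (φ (V 0) - φ 0) := by
        simp [increment, h0]
      rw [this]
      exact abs_mul_le_of_le_one hz0 hz1 ((abs_sub _ _).trans (by linarith [hφ (V 0), hφ 0]))
    calc _ ≤ K + K + 2 * K := (abs_sub _ _).trans (add_le_add ((abs_sub _ _).trans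
            (add_le_add (abs_stateFn_le hz0 hz1 hφ _) (abs_stateFn_le hz0 hz1 hφ _))) hY)
      _ ≤ _ := by nlinarith

/-- If the first service lasts longer than the time interval. -/
lemma abs_stateFn_sub_le_of_lt_residual (hT : ∀ k, 0 < T k) (hV : ∀ i, 0 ≤ V i)
    (hz0 : 0 ≤ z) (hz1 : z ≤ 1) (hh : 0 < h) (hh1 : h ≤ 1) (hn : 0 < n₀) (hr : h < r₀)
    (hφ : ∀ x, |φ x| ≤ K) (hφ' : ∀ x y, |φ x - φ y| ≤ K * |x - y|)
    (hψ : ∀ x, |ψ x| ≤ K) (hψ' : ∀ x, h ≤ x → |φ (x - h) - φ x + h * ψ x| ≤ K * h ^ 2) :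
    |stateFn z φ (number n₀ r₀ T V h, residual n₀ r₀ T V h) - stateFn z φ (n₀, r₀)
      - increment z φ ψ h (n₀, r₀) (T 0) (V 0) (V 1)|
      ≤ 4 * K * incrementError h (n₀, r₀) (T 0) (T 1) (V 0) (V 1) := by
  have hK : 0 ≤ K := (abs_nonneg _).trans (hφ 0)
  have hz : 0 ≤ z ^ n₀ := pow_nonneg hz0 _
  have hz' : z ^ n₀ ≤ 1 := pow_le_one₀ hz0 hz1
  have hn0 : n₀ ≠ 0 := hn.ne'
  have hY : increment z φ ψ h (n₀, r₀) (T 0) (V 0) (V 1)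
      = z ^ n₀ * (-(h * ψ r₀) - (if T 0 ≤ h then 1 else 0) * ((1 - z) * φ r₀)) := by
    simp only [increment, hn, hr, hn0, hr.not_ge]
    simp only [and_self, if_true, if_false, and_false]
    ring
  by_cases h0 : h < T 0
  · obtain ⟨e1, e2⟩ := state_of_lt_residual hT hV hh.le h0 hn hr
    have herr : h ^ 2 ≤ incrementError h (n₀, r₀) (T 0) (T 1) (V 0) (V 1) := by
      simp only [incrementError, h0.not_ge, hr.not_ge]
      simp
    calc _ = |z ^ n₀ * (φ (r₀ - h) - φ r₀ + h * ψ r₀)| := by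
            congr 1
            rw [hY]
            simp [stateFn, e1, e2, h0.not_ge, hn0]
            ring
      _ ≤ K * h ^ 2 := abs_mul_le_of_le_one hz hz' (hψ' r₀ hr.le)
      _ ≤ _ := by nlinarith [sq_nonneg h]
  push Not at h0
  by_cases h1 : h < T 0 + T 1
  · obtain ⟨e1, e2⟩ := state_of_lt_residual_of_le hT hV h0 h1 hn hr
    have herr : h ^ 2 + h ≤ incrementError h (n₀, r₀) (T 0) (T 1) (V 0) (V 1) := by
      simp only [incrementError, h0, hr.not_ge]
      simp only [if_true, and_false, if_false]
      split_ifs <;> linarith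
    -- The arrival multiplies the new value by `z`: the Taylor error remains, together with the
    -- displacement of `φ` by `h` at the moment of the arrival.
    calc _ = |z ^ n₀ * ((φ (r₀ - h) - φ r₀ + h * ψ r₀) - (1 - z) * (φ (r₀ - h) - φ r₀))| := by
            congr 1
            rw [hY]
            simp [stateFn, e1, e2, h0, hn0]
            ring
      _ ≤ K * h ^ 2 + K * h := by
          refine abs_mul_le_of_le_one hz hz' ((abs_sub _ _).trans (add_le_add (hψ' r₀ hr.le) ?_))
          refine abs_mul_le_of_le_one (by linarith) (by linarith) ((hφ' _ _).trans ?_)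
          rw [show r₀ - h - r₀ = -h by ring, abs_neg, abs_of_pos hh]
      _ ≤ _ := by nlinarith [sq_nonneg h]
  · have herr : 1 ≤ incrementError h (n₀, r₀) (T 0) (T 1) (V 0) (V 1) := by
      have : T 1 ≤ h := by linarith [hT 0]
      simp only [incrementError, h0, hr.not_ge, this]
      simp only [if_true, and_false, if_false]
      split_ifs <;> nlinarith [sq_nonneg h]
    have hY' : |increment z φ ψ h (n₀, r₀) (T 0) (V 0) (V 1)| ≤ 2 * K := by
      rw [hY]
      refine abs_mul_le_of_le_one hz hz' ((abs_sub _ _).trans ?_)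
      have h2 : |h * ψ r₀| ≤ K := abs_mul_le_of_le_one hh.le hh1 (hψ _)
      have h3 : |(1 - z) * φ r₀| ≤ K :=
        abs_mul_le_of_le_one (by linarith) (by linarith) (hφ _)
      rw [abs_neg, if_pos h0, one_mul]
      linarith
    calc _ ≤ K + K + 2 * K := (abs_sub _ _).trans (add_le_add ((abs_sub _ _).trans
            (add_le_add (abs_stateFn_le hz0 hz1 hφ _) (abs_stateFn_le hz0 hz1 hφ _))) hY')
      _ ≤ _ := by nlinarith

/-- If the first service ends in the time interval. -/
lemma abs_stateFn_sub_le_of_residual_le (hT : ∀ k, 0 < T k) (hV : ∀ i, 0 ≤ V i)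
    (hz0 : 0 ≤ z) (hz1 : z ≤ 1) (hh : 0 < h) (hn : 0 < n₀) (hr0 : 0 < r₀)
    (hr : r₀ ≤ h) (hφ : ∀ x, |φ x| ≤ K) (hφ' : ∀ x y, |φ x - φ y| ≤ K * |x - y|) :
    |stateFn z φ (number n₀ r₀ T V h, residual n₀ r₀ T V h) - stateFn z φ (n₀, r₀)
      - increment z φ ψ h (n₀, r₀) (T 0) (V 0) (V 1)|
      ≤ 4 * K * incrementError h (n₀, r₀) (T 0) (T 1) (V 0) (V 1) := by
  have hK : 0 ≤ K := (abs_nonneg _).trans (hφ 0)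
  have hn0 : n₀ ≠ 0 := hn.ne'
  have hY : increment z φ ψ h (n₀, r₀) (T 0) (V 0) (V 1)
      = (if 2 ≤ n₀ then z ^ (n₀ - 1) else 0) * (φ (V 1) - z * φ 0) := by
    simp [increment, hr, hn0, hr.not_gt]
  have herr0 : h + (if T 0 ≤ h then 1 else 0) + (if V 1 < h then 1 else 0)
      ≤ incrementError h (n₀, r₀) (T 0) (T 1) (V 0) (V 1) := by
    simp only [incrementError, hn, hr]
    simp only [and_self, if_true, one_mul]
    have : 0 ≤ h ^ 2 + h * (if T 0 ≤ h then 1 else 0)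
        + (if T 0 ≤ h then 1 else 0) * (if T 1 ≤ h then 1 else 0)
        + (if T 0 ≤ h then 1 else 0) * (if V 0 < h then 1 else 0) := by positivity
    linarith
  by_cases h01 : h < T 0 ∧ h ≤ V 1
  · obtain ⟨h0, h1⟩ := h01
    have herr : h ≤ incrementError h (n₀, r₀) (T 0) (T 1) (V 0) (V 1) := by
      simpa [h0.not_ge, h1.not_gt] using herr0
    by_cases hn2 : 2 ≤ n₀
    · obtain ⟨e1, e2⟩ := state_of_residual_le hT hV hr0 hh.le h0 hn2 hr h1
      obtain ⟨m, rfl⟩ : ∃ m, n₀ = m + 2 := ⟨n₀ - 2, by omega⟩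
      calc _ = |z ^ (m + 1) * ((φ (r₀ + V 1 - h) - φ (V 1)) - z * (φ r₀ - φ 0))| := by
              congr 1
              rw [hY]
              simp only [stateFn, e1, e2]
              simp
              ring
        _ ≤ K * h + K * h := by
            refine abs_mul_le_of_le_one (pow_nonneg hz0 _) (pow_le_one₀ hz0 hz1)
              ((abs_sub _ _).trans (add_le_add ((hφ' _ _).trans ?_)
                (abs_mul_le_of_le_one hz0 hz1 ((hφ' _ _).trans ?_))))
            all_goals
              gcongr
              rw [abs_le]
              constructor <;> linarith
        _ ≤ _ := by nlinarith
    · obtain rfl : n₀ = 1 := by omega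
      have e1 := number_of_last_departure hT hV hr0.le h0 hh.le hr
      -- The value `z * φ 0` assigned to the empty state makes the last departure continuous, so no
      -- jump term is needed when `n₀ = 1`.
      calc _ = |z * (φ 0 - φ r₀)| := by
              congr 1
              rw [hY]
              simp [stateFn, e1]
              ring
        _ ≤ K * h := by
            refine abs_mul_le_of_le_one hz0 hz1 ((hφ' _ _).trans ?_)
            gcongr
            rw [abs_le]
            constructor <;> linarith
        _ ≤ _ := by nlinarith
  · have herr : 1 ≤ incrementError h (n₀, r₀) (T 0) (T 1) (V 0) (V 1) := by
      refine le_trans ?_ herr0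
      by_cases h0 : h < T 0
      · have : V 1 < h := lt_of_not_ge fun hc => h01 ⟨h0, hc⟩
        simp only [this, if_true]
        split_ifs <;> linarith
      · simp only [not_lt.1 h0, if_true]
        split_ifs <;> linarith
    have hY' : |increment z φ ψ h (n₀, r₀) (T 0) (V 0) (V 1)| ≤ 2 * K := by
      rw [hY]
      refine abs_mul_le_of_le_one ?_ ?_ ((abs_sub _ _).trans ?_)
      · positivity
      · split_ifs
        exacts [pow_le_one₀ hz0 hz1, zero_le_one]
      · linarith [hφ (V 1), abs_mul_le_of_le_one hz0 hz1 (hφ 0)]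
    calc _ ≤ K + K + 2 * K := (abs_sub _ _).trans (add_le_add ((abs_sub _ _).trans
            (add_le_add (abs_stateFn_le hz0 hz1 hφ _) (abs_stateFn_le hz0 hz1 hφ _))) hY')
      _ ≤ _ := by nlinarith

/-- To first order at most one event happens: an arrival or a service completion. Every other path
has two rare events within time `h`; there `incrementError` is at least `1` and the crude bound `4 *
K` suffices. -/
lemma abs_stateFn_sub_le (hT : ∀ k, 0 < T k) (hV : ∀ i, 0 ≤ V i)
    (hz0 : 0 ≤ z) (hz1 : z ≤ 1) (hh : 0 < h) (hh1 : h ≤ 1)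
    (hr : n₀ ≠ 0 → 0 < r₀) (hr0 : n₀ = 0 → r₀ = 0)
    (hφ : ∀ x, |φ x| ≤ K) (hφ' : ∀ x y, |φ x - φ y| ≤ K * |x - y|)
    (hψ : ∀ x, |ψ x| ≤ K) (hψ' : ∀ x, h ≤ x → |φ (x - h) - φ x + h * ψ x| ≤ K * h ^ 2) :
    |stateFn z φ (number n₀ r₀ T V h, residual n₀ r₀ T V h) - stateFn z φ (n₀, r₀)
      - increment z φ ψ h (n₀, r₀) (T 0) (V 0) (V 1)|
      ≤ 4 * K * incrementError h (n₀, r₀) (T 0) (T 1) (V 0) (V 1) := by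
  rcases Nat.eq_zero_or_pos n₀ with hn | hn
  · rw [hr0 hn, hn]
    exact abs_stateFn_sub_le_of_empty hT hV hz0 hz1 hh hφ hφ'
  · rcases le_or_gt r₀ h with hrh | hrh
    · exact abs_stateFn_sub_le_of_residual_le hT hV hz0 hz1 hh hn (hr hn.ne') hrh hφ hφ'
    · exact abs_stateFn_sub_le_of_lt_residual hT hV hz0 hz1 hh hh1 hn hrh hφ hφ' hψ hψ'

end SingleServer

/-! ### Measurability and independence in the queue -/

lemma measurable_ite_pos_lt (z h : ℝ) {φ : ℝ → ℝ} (hφ : Measurable φ) :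
    Measurable fun x : ℕ × ℝ => if 0 < x.1 ∧ h < x.2 then z ^ x.1 * φ x.2 else 0 := by
  refine Measurable.ite ?_ ?_ measurable_const
  · exact (measurableSet_lt measurable_const measurable_fst).inter
      (measurableSet_lt measurable_const measurable_snd)
  · exact ((measurable_from_nat (f := fun n => z ^ n)).comp measurable_fst).mul
      (hφ.comp measurable_snd)

lemma abs_ite_pos_lt_le {z h K : ℝ} (hz0 : 0 ≤ z) (hz1 : z ≤ 1) {φ : ℝ → ℝ} (hφ : ∀ x, |φ x| ≤ K)
    (x : ℕ × ℝ) : ‖if 0 < x.1 ∧ h < x.2 then z ^ x.1 * φ x.2 else 0‖ ≤ K := by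
  have hK : 0 ≤ K := (abs_nonneg _).trans (hφ 0)
  split_ifs
  · exact SingleServer.abs_mul_le_of_le_one (pow_nonneg hz0 _) (pow_le_one₀ hz0 hz1) (hφ _)
  · simpa

namespace IsMG1Queue

variable {Ω : Type*} [MeasurableSpace Ω] {P : Measure Ω} {lam : ℝ}
  {S : Ω → ℝ} {T V : ℕ → Ω → ℝ} {N₀ : Ω → ℕ} {R₀ : Ω → ℝ}

lemma measurable_state (hq : IsMG1Queue P lam S T V N₀ R₀) :
    Measurable fun ω => (N₀ ω, R₀ ω) :=
  hq.measurable_number.prodMk hq.measurable_residual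

lemma integral_state_mul (hq : IsMG1Queue P lam S T V N₀ R₀) {F : ℕ × ℝ → ℝ}
    {G : (ℕ → ℝ) × (ℕ → ℝ) → ℝ} (hF : Measurable F) (hG : Measurable G)
    (hFi : Integrable (fun ω => F (N₀ ω, R₀ ω)) P)
    (hGi : Integrable (fun ω => G (fun k => T k ω, fun i => V i ω)) P) :
    Integrable (fun ω => F (N₀ ω, R₀ ω) * G (fun k => T k ω, fun i => V i ω)) P ∧
    ∫ ω, F (N₀ ω, R₀ ω) * G (fun k => T k ω, fun i => V i ω) ∂P
      = (∫ ω, F (N₀ ω, R₀ ω) ∂P) * ∫ ω, G (fun k => T k ω, fun i => V i ω) ∂P := by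
  have h := hq.indep_initial.comp hF hG
  exact ⟨h.integrable_mul hFi hGi,
    h.integral_fun_mul_eq_mul_integral hFi.aestronglyMeasurable hGi.aestronglyMeasurable⟩

lemma integral_interarrival_mul_service (hq : IsMG1Queue P lam S T V N₀ R₀) (i j : ℕ)
    {f g : ℝ → ℝ} (hf : Measurable f) (hg : Measurable g)
    (hfi : Integrable (fun ω => f (T i ω)) P) (hgi : Integrable (fun ω => g (V j ω)) P) :
    Integrable (fun ω => f (T i ω) * g (V j ω)) P ∧
    ∫ ω, f (T i ω) * g (V j ω) ∂P = (∫ ω, f (T i ω) ∂P) * ∫ ω, g (V j ω) ∂P := by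
  have h := hq.indep_arrival_service.comp (hf.comp (measurable_pi_apply i))
    (hg.comp (measurable_pi_apply j))
  exact ⟨h.integrable_mul hfi hgi,
    h.integral_fun_mul_eq_mul_integral hfi.aestronglyMeasurable hgi.aestronglyMeasurable⟩

lemma integral_interarrival_mul (hq : IsMG1Queue P lam S T V N₀ R₀) {i j : ℕ} (hij : i ≠ j)
    {f g : ℝ → ℝ} (hf : Measurable f) (hg : Measurable g)
    (hfi : Integrable (fun ω => f (T i ω)) P) (hgi : Integrable (fun ω => g (T j ω)) P) :
    Integrable (fun ω => f (T i ω) * g (T j ω)) P ∧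
    ∫ ω, f (T i ω) * g (T j ω) ∂P = (∫ ω, f (T i ω) ∂P) * ∫ ω, g (T j ω) ∂P := by
  have h := (hq.interarrival_indep.indepFun hij).comp hf hg
  exact ⟨h.integrable_mul hfi hgi,
    h.integral_fun_mul_eq_mul_integral hfi.aestronglyMeasurable hgi.aestronglyMeasurable⟩

lemma integral_interarrival_le (hq : IsMG1Queue P lam S T V N₀ R₀) (hlam : 0 < lam) (k : ℕ) {h : ℝ}
    (hh : 0 ≤ h) :
    ∫ ω, (if T k ω ≤ h then 1 else 0 : ℝ) ∂P = 1 - Real.exp (-(lam * h)) := by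
  have := isProbabilityMeasure_expMeasure hlam
  have h1 : (fun ω => (if T k ω ≤ h then 1 else 0 : ℝ)) = (T k ⁻¹' Set.Iic h).indicator 1 := by
    ext ω; simp [Set.indicator]
  rw [h1, integral_indicator_one (hq.measurable_interarrival k measurableSet_Iic),
    ← map_measureReal_apply (hq.measurable_interarrival k) measurableSet_Iic,
    hq.interarrival_law k, ← cdf_eq_real, cdf_expMeasure_eq hlam, if_pos hh]

lemma ae_interarrival_pos (hq : IsMG1Queue P lam S T V N₀ R₀) (hlam : 0 < lam) :
    ∀ᵐ ω ∂P, ∀ k, 0 < T k ω := by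
  rw [ae_all_iff]
  intro k
  have := isProbabilityMeasure_expMeasure hlam
  have : IsProbabilityMeasure P := hq.interarrival_indep.isProbabilityMeasure
  have h0 : P.real (T k ⁻¹' Set.Iic 0) = 0 := by
    rw [← map_measureReal_apply (hq.measurable_interarrival k) measurableSet_Iic,
      hq.interarrival_law k, ← cdf_eq_real, cdf_expMeasure_eq hlam]
    simp
  rw [measureReal_eq_zero_iff] at h0
  filter_upwards [measure_eq_zero_iff_ae_notMem.1 h0] with ω hω
  simpa using hω

lemma ae_service_nonneg (hq : IsMG1Queue P lam S T V N₀ R₀) (hS : ∀ᵐ ω ∂P, 0 ≤ S ω) :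
    ∀ᵐ ω ∂P, ∀ i, 0 ≤ V i ω := by
  rw [ae_all_iff]
  exact fun i => (hq.service_law i).symm.ae_snd measurableSet_Ici hS

lemma integral_service (hq : IsMG1Queue P lam S T V N₀ R₀) (i : ℕ) {f : ℝ → ℝ}
    (hf : Measurable f) : ∫ ω, f (V i ω) ∂P = ∫ ω, f (S ω) ∂P :=
  ((hq.service_law i).comp hf).integral_eq

end IsMG1Queue

/-! ### The balance equation in equilibrium -/

namespace IsMG1Queue

variable {Ω : Type*} [MeasurableSpace Ω] {P : Measure Ω} {lam : ℝ} {S : Ω → ℝ}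
  {T V : ℕ → Ω → ℝ} {N₀ : Ω → ℕ} {R₀ : Ω → ℝ} [IsProbabilityMeasure P]

/-- Independence of the initial state, the first interarrival time and the service times factorizes
each term. The completion term carries the centred factor `φ(V 1) - z * φ 0`, whose mean vanishes by
`hbd`; this is why that boundary condition is imposed. -/
lemma integral_increment (hq : IsMG1Queue P lam S T V N₀ R₀) (hlam : 0 < lam) {z K h : ℝ}
    (hz0 : 0 ≤ z) (hz1 : z ≤ 1) (hh : 0 < h) {φ ψ : ℝ → ℝ}
    (hφm : Measurable φ) (hψm : Measurable ψ) (hφ : ∀ x, |φ x| ≤ K) (hψ : ∀ x, |ψ x| ≤ K)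
    (hbd : ∫ ω, φ (S ω) ∂P = z * φ 0) :
    Integrable (fun ω => SingleServer.increment z φ ψ h (N₀ ω, R₀ ω) (T 0 ω) (V 0 ω) (V 1 ω)) P ∧
    ∫ ω, SingleServer.increment z φ ψ h (N₀ ω, R₀ ω) (T 0 ω) (V 0 ω) (V 1 ω) ∂P
      = (-h) * (∫ ω, (if 0 < N₀ ω ∧ h < R₀ ω then z ^ N₀ ω * ψ (R₀ ω) else 0) ∂P)
        - (1 - z) * ((∫ ω, (if 0 < N₀ ω ∧ h < R₀ ω then z ^ N₀ ω * φ (R₀ ω) else 0) ∂P)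
          * (1 - Real.exp (-(lam * h))))
        + z * ((∫ ω, (if N₀ ω = 0 then 1 else 0 : ℝ) ∂P)
          * ((1 - Real.exp (-(lam * h))) * (z * φ 0 - φ 0))) := by
  have hi0m : Measurable fun t : ℝ => (if t ≤ h then 1 else 0 : ℝ) :=
    Measurable.ite measurableSet_Iic measurable_const measurable_const
  have hi0 : Integrable (fun ω => (if T 0 ω ≤ h then 1 else 0 : ℝ)) P :=
    Integrable.of_bound (hi0m.comp (hq.measurable_interarrival 0)).aestronglyMeasurable 1
      (ae_of_all _ fun ω => by split_ifs <;> simp)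
  have hF : ∀ {f : ℝ → ℝ}, Measurable f → (∀ x, |f x| ≤ K) →
      Integrable (fun ω => if 0 < N₀ ω ∧ h < R₀ ω then z ^ N₀ ω * f (R₀ ω) else 0) P :=
    fun {f} hfm hf => Integrable.of_bound
      ((measurable_ite_pos_lt z h hfm).comp hq.measurable_state).aestronglyMeasurable K
      (ae_of_all _ fun ω => abs_ite_pos_lt_le hz0 hz1 hf (N₀ ω, R₀ ω))
  have hE : Measurable fun x : ℕ × ℝ => (if x.1 = 0 then 1 else 0 : ℝ) :=
    (measurable_from_nat (f := fun n => (if n = 0 then 1 else 0 : ℝ))).comp measurable_fst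
  have hEi : Integrable (fun ω => (if N₀ ω = 0 then 1 else 0 : ℝ)) P :=
    Integrable.of_bound (hE.comp hq.measurable_state).aestronglyMeasurable 1
      (ae_of_all _ fun ω => by split_ifs <;> simp)
  have hG : Measurable fun x : ℕ × ℝ => (if 2 ≤ x.1 ∧ x.2 ≤ h then z ^ (x.1 - 1) else 0 : ℝ) :=
    Measurable.ite ((measurableSet_le measurable_const measurable_fst).inter
      (measurableSet_le measurable_snd measurable_const))
      ((measurable_from_nat (f := fun n => z ^ (n - 1))).comp measurable_fst) measurable_const
  have hGi : Integrable (fun ω => (if 2 ≤ N₀ ω ∧ R₀ ω ≤ h then z ^ (N₀ ω - 1) else 0 : ℝ)) P :=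
    Integrable.of_bound (hG.comp hq.measurable_state).aestronglyMeasurable 1
      (ae_of_all _ fun ω => by
        split_ifs
        · rw [Real.norm_of_nonneg (pow_nonneg hz0 _)]; exact pow_le_one₀ hz0 hz1
        · simp)
  have hφi : ∀ i, Integrable (fun ω => φ (V i ω)) P := fun i =>
    Integrable.of_bound (hφm.comp (hq.measurable_service i)).aestronglyMeasurable K
      (ae_of_all _ fun ω => hφ _)
  have hφs : ∀ (i : ℕ) (c : ℝ), ∫ ω, (φ (V i ω) - c) ∂P = z * φ 0 - c := fun i c => by
    rw [integral_sub (hφi i) (integrable_const _), hq.integral_service i hφm, hbd]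
    simp
  have h2 := hq.integral_state_mul (measurable_ite_pos_lt z h hφm)
    (hi0m.comp ((measurable_pi_apply 0).comp measurable_fst)) (hF hφm hφ) hi0
  have h3' := hq.integral_interarrival_mul_service 0 0 hi0m (hφm.sub_const (φ 0)) hi0
    ((hφi 0).sub (integrable_const _))
  have h3 := hq.integral_state_mul hE
    (G := fun x => (if x.1 0 ≤ h then 1 else 0) * (φ (x.2 0) - φ 0))
    ((hi0m.comp ((measurable_pi_apply 0).comp measurable_fst)).mul
      ((hφm.comp ((measurable_pi_apply 0).comp measurable_snd)).sub_const _)) hEi h3'.1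
  have h4 := hq.integral_state_mul hG
    (G := fun x => φ (x.2 1) - z * φ 0)
    ((hφm.comp ((measurable_pi_apply 1).comp measurable_snd)).sub_const _) hGi
    ((hφi 1).sub (integrable_const _))
  have j1 := (hF hψm hψ).const_mul (-h)
  have j2 := h2.1.const_mul (1 - z)
  have j3 := h3.1.const_mul z
  refine ⟨((j1.sub j2).add j3).add h4.1, ?_⟩
  refine (integral_add ((j1.sub j2).add j3) h4.1).trans ?_
  refine (congrArg₂ (· + ·) (integral_add (j1.sub j2) j3) rfl).trans ?_
  refine (congrArg₂ (· + ·) (congrArg₂ (· + ·) (integral_sub j1 j2) rfl) rfl).trans ?_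
  rw [integral_const_mul, integral_const_mul, integral_const_mul, h2.2, h3.2, h4.2, h3'.2]
  simp only [Function.comp_apply, hφs, sub_self, mul_zero, add_zero,
    hq.integral_interarrival_le hlam 0 hh.le]

/-- Each random product consists of independent small factors. The probability that `R₀ ≤ h` with
the server busy is kept as it stands: it is multiplied by `O(h)`, so it only has to tend to `0`, and
no regularity of the law of `R₀` is required. -/
lemma integral_incrementError_le (hq : IsMG1Queue P lam S T V N₀ R₀) (hlam : 0 < lam) {h c : ℝ}
    (hh : 0 < h) (hc : ∫ ω, (if S ω < h then 1 else 0 : ℝ) ∂P ≤ c * h) :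
    Integrable (fun ω => SingleServer.incrementError h (N₀ ω, R₀ ω) (T 0 ω) (T 1 ω)
      (V 0 ω) (V 1 ω)) P ∧
    ∫ ω, SingleServer.incrementError h (N₀ ω, R₀ ω) (T 0 ω) (T 1 ω) (V 0 ω) (V 1 ω) ∂P
      ≤ h * (h * (1 + lam + lam * lam + lam * c)
        + (∫ ω, (if 0 < N₀ ω ∧ R₀ ω ≤ h then 1 else 0 : ℝ) ∂P) * (1 + lam + c)) := by
  have him : Measurable fun t : ℝ => (if t ≤ h then 1 else 0 : ℝ) :=
    Measurable.ite measurableSet_Iic measurable_const measurable_const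
  have hjm : Measurable fun t : ℝ => (if t < h then 1 else 0 : ℝ) :=
    Measurable.ite measurableSet_Iio measurable_const measurable_const
  have hi : ∀ k, Integrable (fun ω => (if T k ω ≤ h then 1 else 0 : ℝ)) P := fun k =>
    Integrable.of_bound (him.comp (hq.measurable_interarrival k)).aestronglyMeasurable 1
      (ae_of_all _ fun ω => by split_ifs <;> simp)
  have hj : ∀ k, Integrable (fun ω => (if V k ω < h then 1 else 0 : ℝ)) P := fun k =>
    Integrable.of_bound (hjm.comp (hq.measurable_service k)).aestronglyMeasurable 1
      (ae_of_all _ fun ω => by split_ifs <;> simp)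
  have hG : Measurable fun x : ℕ × ℝ => (if 0 < x.1 ∧ x.2 ≤ h then 1 else 0 : ℝ) :=
    Measurable.ite ((measurableSet_lt measurable_const measurable_fst).inter
      (measurableSet_le measurable_snd measurable_const)) measurable_const measurable_const
  have hGi : Integrable (fun ω => (if 0 < N₀ ω ∧ R₀ ω ≤ h then 1 else 0 : ℝ)) P :=
    Integrable.of_bound (hG.comp hq.measurable_state).aestronglyMeasurable 1
      (ae_of_all _ fun ω => by split_ifs <;> simp)
  have k3 := hq.integral_interarrival_mul (zero_ne_one) him him (hi 0) (hi 1)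
  have k4 := hq.integral_interarrival_mul_service 0 0 him hjm (hi 0) (hj 0)
  have k5 := hq.integral_state_mul hG
    (G := fun x => h + (if x.1 0 ≤ h then 1 else 0) + (if x.2 1 < h then 1 else 0))
    (((him.comp ((measurable_pi_apply 0).comp measurable_fst)).const_add h).add
      (hjm.comp ((measurable_pi_apply 1).comp measurable_snd))) hGi
    (((integrable_const h).add (hi 0)).add (hj 1))
  have k1 : Integrable (fun _ : Ω => h ^ 2) P := integrable_const _
  have k2 := (hi 0).const_mul h
  have e5 : ∫ ω, (h + (if T 0 ω ≤ h then 1 else 0) + (if V 1 ω < h then 1 else 0)) ∂P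
      = h + (1 - Real.exp (-(lam * h))) + ∫ ω, (if S ω < h then 1 else 0 : ℝ) ∂P := by
    refine (integral_add ((integrable_const h).add (hi 0)) (hj 1)).trans ?_
    refine (congrArg₂ (· + ·) (integral_add (integrable_const h) (hi 0)) rfl).trans ?_
    rw [hq.integral_interarrival_le hlam 0 hh.le,
      hq.integral_service 1 hjm]
    simp
  refine ⟨(((k1.add k2).add k3.1).add k4.1).add k5.1, ?_⟩
  have heq : ∫ ω, SingleServer.incrementError h (N₀ ω, R₀ ω) (T 0 ω) (T 1 ω) (V 0 ω) (V 1 ω) ∂P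
      = h ^ 2 + h * (1 - Real.exp (-(lam * h)))
        + (1 - Real.exp (-(lam * h))) * (1 - Real.exp (-(lam * h)))
        + (1 - Real.exp (-(lam * h))) * (∫ ω, (if S ω < h then 1 else 0 : ℝ) ∂P)
        + (∫ ω, (if 0 < N₀ ω ∧ R₀ ω ≤ h then 1 else 0 : ℝ) ∂P)
          * (h + (1 - Real.exp (-(lam * h))) + ∫ ω, (if S ω < h then 1 else 0 : ℝ) ∂P) := by
    refine (integral_add (((k1.add k2).add k3.1).add k4.1) k5.1).trans ?_
    refine (congrArg₂ (· + ·) (integral_add ((k1.add k2).add k3.1) k4.1) rfl).trans ?_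
    refine (congrArg₂ (· + ·) (congrArg₂ (· + ·)
      (integral_add (k1.add k2) k3.1) rfl) rfl).trans ?_
    refine (congrArg₂ (· + ·) (congrArg₂ (· + ·) (congrArg₂ (· + ·)
      (integral_add k1 k2) rfl) rfl) rfl).trans ?_
    rw [integral_const_mul, k3.2, k4.2, k5.2, e5]
    simp only [hq.integral_interarrival_le hlam _ hh.le, hq.integral_service 0 hjm]
    simp
  have hp0 : 0 ≤ 1 - Real.exp (-(lam * h)) := by
    rw [sub_nonneg, Real.exp_le_one_iff]; nlinarith
  have hp1 : 1 - Real.exp (-(lam * h)) ≤ lam * h := by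
    linarith [Real.add_one_le_exp (-(lam * h))]
  have hs0 : 0 ≤ ∫ ω, (if S ω < h then 1 else 0 : ℝ) ∂P := integral_nonneg fun ω => by positivity
  have hQ : 0 ≤ ∫ ω, (if 0 < N₀ ω ∧ R₀ ω ≤ h then 1 else 0 : ℝ) ∂P :=
    integral_nonneg fun ω => by positivity
  rw [heq]
  generalize (∫ ω, (if 0 < N₀ ω ∧ R₀ ω ≤ h then 1 else 0 : ℝ) ∂P) = Q at *
  generalize (∫ ω, (if S ω < h then 1 else 0 : ℝ) ∂P) = s at *
  generalize 1 - Real.exp (-(lam * h)) = p at *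
  calc _ ≤ h ^ 2 + h * (lam * h) + (lam * h) * (lam * h) + (lam * h) * (c * h)
        + Q * (h + lam * h + c * h) := by gcongr
    _ = _ := by ring

/-- The balance equation for the test function `SingleServer.stateFn z φ` in an interval of
length `h`, with an error term. -/
lemma abs_balance_le (hq : IsMG1Queue P lam S T V N₀ R₀) (heq : InEquilibrium P T V N₀ R₀)
    (hlam : 0 < lam) (hS : ∀ᵐ ω ∂P, 0 ≤ S ω) {z K h c : ℝ}
    (hz0 : 0 ≤ z) (hz1 : z ≤ 1) (hh : 0 < h) (hh1 : h ≤ 1)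
    (hc : ∫ ω, (if S ω < h then 1 else 0 : ℝ) ∂P ≤ c * h) {φ ψ : ℝ → ℝ}
    (hφm : Measurable φ) (hψm : Measurable ψ) (hφ : ∀ x, |φ x| ≤ K) (hψ : ∀ x, |ψ x| ≤ K)
    (hφ' : ∀ x y, |φ x - φ y| ≤ K * |x - y|)
    (hψ' : ∀ x, h ≤ x → |φ (x - h) - φ x + h * ψ x| ≤ K * h ^ 2)
    (hbd : ∫ ω, φ (S ω) ∂P = z * φ 0) :
    |(-h) * (∫ ω, (if 0 < N₀ ω ∧ h < R₀ ω then z ^ N₀ ω * ψ (R₀ ω) else 0) ∂P)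
        - (1 - z) * ((∫ ω, (if 0 < N₀ ω ∧ h < R₀ ω then z ^ N₀ ω * φ (R₀ ω) else 0) ∂P)
          * (1 - Real.exp (-(lam * h))))
        + z * ((∫ ω, (if N₀ ω = 0 then 1 else 0 : ℝ) ∂P)
          * ((1 - Real.exp (-(lam * h))) * (z * φ 0 - φ 0)))|
      ≤ 4 * K * (h * (h * (1 + lam + lam * lam + lam * c)
        + (∫ ω, (if 0 < N₀ ω ∧ R₀ ω ≤ h then 1 else 0 : ℝ) ∂P) * (1 + lam + c))) := by
  have hK : 0 ≤ K := (abs_nonneg _).trans (hφ 0)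
  obtain ⟨hYi, hY⟩ := hq.integral_increment hlam hz0 hz1 hh hφm hψm hφ hψ hbd
  obtain ⟨hEi, hE⟩ := hq.integral_incrementError_le hlam hh hc
  have hgm : Measurable (SingleServer.stateFn z φ) :=
    Measurable.ite (measurable_fst (measurableSet_singleton 0)) measurable_const
      (((measurable_from_nat (f := fun n => z ^ n)).comp measurable_fst).mul
        (hφm.comp measurable_snd))
  have hid := (heq h hh.le).comp hgm
  have hg : ∀ X : Ω → ℕ × ℝ, AEMeasurable X P →
      Integrable (fun ω => SingleServer.stateFn z φ (X ω)) P := fun X hX =>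
    Integrable.of_bound (hgm.comp_aemeasurable hX).aestronglyMeasurable K
      (ae_of_all _ fun ω => SingleServer.abs_stateFn_le hz0 hz1 hφ _)
  have hg0 := hg _ (heq h hh.le).aemeasurable_snd
  have hgh := hg _ (heq h hh.le).aemeasurable_fst
  -- Equilibrium enters here: the test function has the same mean at times `0` and `h`.
  have hzero : ∫ ω, (SingleServer.stateFn z φ
      (queueLength T V N₀ R₀ h ω, residualService T V N₀ R₀ h ω)
      - SingleServer.stateFn z φ (N₀ ω, R₀ ω)) ∂P = 0 := by
    rw [integral_sub hgh hg0, sub_eq_zero]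
    exact hid.integral_eq
  have hdiff := integral_sub (hgh.sub hg0) hYi
  simp only [Pi.sub_apply] at hdiff
  rw [hzero, zero_sub] at hdiff
  rw [← hY, ← abs_neg, ← hdiff]
  refine (abs_integral_le_integral_abs).trans ?_
  refine (integral_mono_ae ((hgh.sub hg0).sub hYi).abs (hEi.const_mul (4 * K)) ?_).trans ?_
  · filter_upwards [hq.ae_interarrival_pos hlam, hq.ae_service_nonneg hS, hq.residual_pos,
      hq.residual_empty] with ω h1 h2 h3 h4
    exact SingleServer.abs_stateFn_sub_le h1 h2 hz0 hz1 hh hh1 h3 h4 hφ hφ' hψ hψ'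
  · rw [integral_const_mul]
    gcongr

/-- The balance equation of the queue in equilibrium. -/
theorem balance (hq : IsMG1Queue P lam S T V N₀ R₀) (heq : InEquilibrium P T V N₀ R₀)
    (hlam : 0 < lam) (hS : ∀ᵐ ω ∂P, 0 ≤ S ω) {z K c : ℝ}
    (hz0 : 0 ≤ z) (hz1 : z ≤ 1)
    (hc : ∀ h, 0 < h → ∫ ω, (if S ω < h then 1 else 0 : ℝ) ∂P ≤ c * h) {φ ψ : ℝ → ℝ}
    (hφm : Measurable φ) (hψm : Measurable ψ) (hφ : ∀ x, |φ x| ≤ K) (hψ : ∀ x, |ψ x| ≤ K)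
    (hφ' : ∀ x y, |φ x - φ y| ≤ K * |x - y|)
    (hψ' : ∀ h x, 0 < h → h ≤ x → |φ (x - h) - φ x + h * ψ x| ≤ K * h ^ 2)
    (hbd : ∫ ω, φ (S ω) ∂P = z * φ 0) :
    (∫ ω, (if 0 < N₀ ω then z ^ N₀ ω * ψ (R₀ ω) else 0) ∂P)
        + (1 - z) * ((∫ ω, (if 0 < N₀ ω then z ^ N₀ ω * φ (R₀ ω) else 0) ∂P) * lam)
      = z * ((∫ ω, (if N₀ ω = 0 then 1 else 0 : ℝ) ∂P) * (lam * (z * φ 0 - φ 0))) := by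
  have hpos : ∀ᵐ ω ∂P, ∀ᶠ h in 𝓝[>] (0 : ℝ), 0 < N₀ ω → h < R₀ ω := by
    filter_upwards [hq.residual_pos] with ω hω
    by_cases hN : 0 < N₀ ω
    · filter_upwards [nhdsWithin_le_nhds (eventually_lt_nhds (hω hN.ne'))] with h hh _ using hh
    · exact Eventually.of_forall fun h h' => absurd h' hN
  have hlim : ∀ {f : ℝ → ℝ}, Measurable f → (∀ x, |f x| ≤ K) → Tendsto (fun h : ℝ =>
      ∫ ω, (if 0 < N₀ ω ∧ h < R₀ ω then z ^ N₀ ω * f (R₀ ω) else 0) ∂P) (𝓝[>] 0)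
      (𝓝 (∫ ω, (if 0 < N₀ ω then z ^ N₀ ω * f (R₀ ω) else 0) ∂P)) := by
    intro f hfm hf
    refine tendsto_integral_filter_of_dominated_convergence (fun _ => K)
      (Eventually.of_forall fun h => ((measurable_ite_pos_lt z h hfm).comp
        hq.measurable_state).aestronglyMeasurable)
      (Eventually.of_forall fun h => ae_of_all _ fun ω =>
        abs_ite_pos_lt_le hz0 hz1 hf (N₀ ω, R₀ ω)) (integrable_const _) ?_
    filter_upwards [hpos] with ω hω
    refine tendsto_const_nhds.congr' ?_
    filter_upwards [hω] with h hh
    by_cases hN : 0 < N₀ ω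
    · simp [hN, hh hN]
    · simp [hN]
  have hQ : Tendsto (fun h : ℝ => ∫ ω, (if 0 < N₀ ω ∧ R₀ ω ≤ h then 1 else 0 : ℝ) ∂P) (𝓝[>] 0)
      (𝓝 0) := by
    have hG : ∀ h, Measurable fun x : ℕ × ℝ => (if 0 < x.1 ∧ x.2 ≤ h then 1 else 0 : ℝ) :=
      fun h => Measurable.ite ((measurableSet_lt measurable_const measurable_fst).inter
        (measurableSet_le measurable_snd measurable_const)) measurable_const measurable_const
    suffices Tendsto (fun h : ℝ => ∫ ω, (if 0 < N₀ ω ∧ R₀ ω ≤ h then 1 else 0 : ℝ) ∂P) (𝓝[>] 0)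
        (𝓝 (∫ _, 0 ∂P)) by simpa only [integral_zero] using this
    refine tendsto_integral_filter_of_dominated_convergence (fun _ => 1)
      (Eventually.of_forall fun h => ((hG h).comp hq.measurable_state).aestronglyMeasurable)
      (Eventually.of_forall fun h => ae_of_all _ fun ω => by split_ifs <;> simp)
      (integrable_const _) ?_
    filter_upwards [hpos] with ω hω
    refine tendsto_const_nhds.congr' ?_
    filter_upwards [hω] with h hh
    by_cases hN : 0 < N₀ ω
    · simp [(hh hN).not_ge]
    · simp [hN]
  have hp : Tendsto (fun h : ℝ => (1 - Real.exp (-(lam * h))) / h) (𝓝[>] 0) (𝓝 lam) := by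
    have hd : HasDerivAt (fun h : ℝ => 1 - Real.exp (-(lam * h))) lam 0 := by
      have h1 : HasDerivAt (fun h : ℝ => -(lam * h)) (-lam) 0 := by
        simpa using ((hasDerivAt_id (0 : ℝ)).const_mul lam).fun_neg
      simpa using h1.exp.const_sub 1
    have := (hasDerivAt_iff_tendsto_slope.1 hd).mono_left
      (nhdsWithin_mono 0 (fun x (hx : 0 < x) => hx.ne'))
    refine this.congr fun h => ?_
    simp [slope_def_field]
  have hh0 : Tendsto (fun h : ℝ => h) (𝓝[>] 0) (𝓝 0) := nhdsWithin_le_nhds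
  have hleft := (((hlim hψm hψ).neg.sub (((hlim hφm hφ).mul hp).const_mul (1 - z))).add
    (((hp.mul_const (z * φ 0 - φ 0)).const_mul
      (∫ ω, (if N₀ ω = 0 then 1 else 0 : ℝ) ∂P)).const_mul z))
  have hright := ((hh0.mul_const (1 + lam + lam * lam + lam * c)).add
    (hQ.mul_const (1 + lam + c))).const_mul (4 * K)
  simp only [zero_mul, add_zero, mul_zero] at hright
  -- After division by `h` the error bound tends to `0`, and `(1 - exp (-(lam * h))) / h` tends to
  -- `lam`.
  have hsq := squeeze_zero_norm' (a := fun h : ℝ => 4 * K * (h * (1 + lam + lam * lam + lam * c)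
      + (∫ ω, (if 0 < N₀ ω ∧ R₀ ω ≤ h then 1 else 0 : ℝ) ∂P) * (1 + lam + c)))
      (f := fun h : ℝ =>
        -(∫ ω, (if 0 < N₀ ω ∧ h < R₀ ω then z ^ N₀ ω * ψ (R₀ ω) else 0) ∂P)
        - (1 - z) * ((∫ ω, (if 0 < N₀ ω ∧ h < R₀ ω then z ^ N₀ ω * φ (R₀ ω) else 0) ∂P)
          * ((1 - Real.exp (-(lam * h))) / h))
        + z * ((∫ ω, (if N₀ ω = 0 then 1 else 0 : ℝ) ∂P)
          * ((1 - Real.exp (-(lam * h))) / h * (z * φ 0 - φ 0)))) ?_ hright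
  · have := tendsto_nhds_unique hleft hsq
    linarith
  · filter_upwards [self_mem_nhdsWithin, nhdsWithin_le_nhds (eventually_le_nhds one_pos)]
      with h hh hh1
    have hh : 0 < h := hh
    have hb := hq.abs_balance_le heq hlam hS hz0 hz1 hh hh1 (hc h hh) hφm hψm hφ hψ hφ'
      (fun x hx => hψ' h x hh hx) hbd
    rw [Real.norm_eq_abs]
    refine le_of_mul_le_mul_left ?_ hh
    nth_rewrite 1 [← abs_of_pos hh]
    rw [← abs_mul]
    convert! hb using 1
    · congr 1
      field_simp
    · ring

end IsMG1Queue

/-! ### Consequences of NBUE for the service time -/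

section NBUE

variable {Ω : Type*} [MeasurableSpace Ω] {P : Measure Ω} [IsProbabilityMeasure P] {S : Ω → ℝ}

/-- The defining inequality of `IsNBUE`, written without conditional expectations. -/
lemma IsNBUE.integral_max_sub_le (hN : IsNBUE P S) (hS : Integrable S P) {t : ℝ} (ht : 0 ≤ t) :
    ∫ ω, max (S ω - t) 0 ∂P ≤ (∫ ω, S ω ∂P) * P.real {ω | t ≤ S ω} := by
  have hms : NullMeasurableSet {ω | t ≤ S ω} P :=
    nullMeasurableSet_le aemeasurable_const hS.aemeasurable
  have hind : ∫ ω, max (S ω - t) 0 ∂P = ∫ ω in {ω | t ≤ S ω}, (S ω - t) ∂P := by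
    rw [← integral_indicator₀ hms]
    refine integral_congr_ae (ae_of_all _ fun ω => ?_)
    by_cases h : t ≤ S ω
    · simp [Set.indicator, h]
    · simp [Set.indicator, h, (not_le.1 h).le]
  rw [hind]
  by_cases h0 : P {ω | t ≤ S ω} = 0
  · rw [Measure.restrict_eq_zero.2 h0, measureReal_def, h0]
    simp
  have h := hN t ht h0
  rw [ProbabilityTheory.cond, integral_smul_measure, smul_eq_mul, ENNReal.toReal_inv,
    inv_mul_le_iff₀ (ENNReal.toReal_pos h0 (measure_ne_top _ _)), mul_comm] at h
  exact h

/-- NBUE at `h` gives `E S - h ≤ E (S - h)⁺ ≤ E S * P(S ≥ h)`. This linear bound makes it negligible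
that a service begins and ends within a time `h`. -/
lemma IsNBUE.integral_lt_le (hN : IsNBUE P S) (hS : Integrable S P) (hpos : 0 < ∫ ω, S ω ∂P)
    {h : ℝ} (hh : 0 < h) :
    ∫ ω, (if S ω < h then 1 else 0 : ℝ) ∂P ≤ (∫ ω, S ω ∂P)⁻¹ * h := by
  have hms : NullMeasurableSet {ω | h ≤ S ω} P :=
    nullMeasurableSet_le aemeasurable_const hS.aemeasurable
  have h1 : ∫ ω, (if S ω < h then 1 else 0 : ℝ) ∂P = 1 - P.real {ω | h ≤ S ω} := by
    rw [← probReal_compl_eq_one_sub₀ hms]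
    have hc := integral_indicator₀ (μ := P) (f := fun _ => (1 : ℝ)) hms.compl
    simp only [integral_const, smul_eq_mul, mul_one, measureReal_restrict_apply_univ] at hc
    rw [← hc]
    refine integral_congr_ae (ae_of_all _ fun ω => ?_)
    simp [Set.indicator]
  have h2 : (∫ ω, S ω ∂P) - h ≤ ∫ ω, max (S ω - h) 0 ∂P := by
    have : ∫ ω, (S ω - h) ∂P = (∫ ω, S ω ∂P) - h := by
      rw [integral_sub hS (integrable_const _)]; simp
    rw [← this]
    exact integral_mono (hS.sub (integrable_const _)) ((hS.sub (integrable_const _)).pos_part)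
      fun ω => le_max_left _ _
  have h3 := hN.integral_max_sub_le hS hh.le
  rw [h1, le_inv_mul_iff₀ hpos]
  nlinarith

end NBUE

/-! ### Regularity of the exponential test function -/

section ExpTest

variable {C μ : ℝ}

lemma abs_exp_neg_max_sub_le (hμ : 0 < μ) (x y : ℝ) :
    |Real.exp (-(μ * max x 0)) - Real.exp (-(μ * max y 0))| ≤ μ * |x - y| := by
  have key : ∀ x y : ℝ, 0 ≤ x → x ≤ y →
      |Real.exp (-(μ * x)) - Real.exp (-(μ * y))| ≤ μ * (y - x) := by
    intro x y hx hxy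
    have h1 : Real.exp (-(μ * y)) = Real.exp (-(μ * x)) * Real.exp (-(μ * (y - x))) := by
      rw [← Real.exp_add]; ring_nf
    have h2 : Real.exp (-(μ * x)) ≤ 1 := Real.exp_le_one_iff.2 (by nlinarith)
    have h3 := Real.add_one_le_exp (-(μ * (y - x)))
    have h4 : Real.exp (-(μ * (y - x))) ≤ 1 := Real.exp_le_one_iff.2 (by nlinarith)
    rw [h1, ← mul_one_sub, abs_mul, abs_of_pos (Real.exp_pos _), abs_of_nonneg (by linarith)]
    calc _ ≤ 1 * (1 - Real.exp (-(μ * (y - x)))) := by gcongr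
      _ ≤ _ := by linarith
  have hlip : |max x 0 - max y 0| ≤ |x - y| := abs_max_sub_max_le_abs x y 0
  refine le_trans ?_ (mul_le_mul_of_nonneg_left hlip hμ.le)
  rcases le_total (max x 0) (max y 0) with h | h
  · rw [abs_sub_comm (max x 0), abs_of_nonneg (sub_nonneg.2 h)]
    exact key _ _ (le_max_right _ _) h
  · rw [abs_sub_comm, abs_of_nonneg (sub_nonneg.2 h)]
    exact key _ _ (le_max_right _ _) h

lemma abs_exp_neg_max_taylor_le (hμ : 0 < μ) {h x : ℝ} (hh : 0 < h) (hx : h ≤ x) :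
    |Real.exp (-(μ * max (x - h) 0)) - Real.exp (-(μ * max x 0))
      - h * (μ * Real.exp (-(μ * max x 0)))| ≤ μ ^ 2 * h ^ 2 := by
  rw [max_eq_left (by linarith), max_eq_left (by linarith)]
  have h1 : Real.exp (-(μ * x)) = Real.exp (-(μ * (x - h))) * Real.exp (-(μ * h)) := by
    rw [← Real.exp_add]; ring_nf
  have h2 : Real.exp (-(μ * (x - h))) ≤ 1 := Real.exp_le_one_iff.2 (by nlinarith)
  have h3 := Real.add_one_le_exp (-(μ * h))
  have h4 : Real.exp (-(μ * h)) * (1 + μ * h) ≤ 1 := by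
    have := Real.add_one_le_exp (μ * h)
    calc _ ≤ Real.exp (-(μ * h)) * Real.exp (μ * h) := by gcongr; linarith
      _ = 1 := by rw [← Real.exp_add]; simp
  have hu : 0 < μ * h := mul_pos hμ hh
  have heq : Real.exp (-(μ * (x - h))) - Real.exp (-(μ * x)) - h * (μ * Real.exp (-(μ * x)))
      = Real.exp (-(μ * (x - h))) * (1 - Real.exp (-(μ * h)) * (1 + μ * h)) := by
    rw [h1]; ring
  rw [heq, abs_mul, abs_of_pos (Real.exp_pos _), abs_of_nonneg (by linarith)]
  calc _ ≤ 1 * (1 - Real.exp (-(μ * h)) * (1 + μ * h)) := by gcongr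
    -- With `u = μ * h`, the bound `exp (-u) ≥ 1 - u` gives `1 - exp (-u) * (1 + u) ≤ u ^ 2`.
    _ ≤ _ := by nlinarith

end ExpTest

/-! ### The Pollaczek–Khinchine formula -/

namespace IsMG1Queue

variable {Ω : Type*} [MeasurableSpace Ω] {P : Measure Ω} {lam : ℝ} {S : Ω → ℝ}
  {T V : ℕ → Ω → ℝ} {N₀ : Ω → ℕ} {R₀ : Ω → ℝ} [IsProbabilityMeasure P]

/-- The Pollaczek–Khinchine formula for the probability generating function of the number of
customers in the system. -/
theorem pollaczek_khinchine (hq : IsMG1Queue P lam S T V N₀ R₀) (heq : InEquilibrium P T V N₀ R₀)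
    (hlam : 0 < lam) (hS : ∀ᵐ ω ∂P, 0 ≤ S ω) (hSi : Integrable S P)
    (hpos : 0 < ∫ ω, S ω ∂P) (hρ : lam * ∫ ω, S ω ∂P < 1) (hN : IsNBUE P S)
    {z : ℝ} (hz0 : 0 < z) (hz1 : z < 1) :
    (∫ ω, z ^ N₀ ω ∂P) * ((∫ ω, Real.exp (-(lam * (1 - z) * S ω)) ∂P) - z)
      = (∫ ω, (if N₀ ω = 0 then 1 else 0 : ℝ) ∂P) * (1 - z)
        * ∫ ω, Real.exp (-(lam * (1 - z) * S ω)) ∂P := by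
  set μ := lam * (1 - z) with hμ_def
  have hμ : 0 < μ := mul_pos hlam (by linarith)
  set s := ∫ ω, Real.exp (-(μ * S ω)) ∂P with hs_def
  have hmeas : Measurable fun x : ℝ => Real.exp (-(μ * max x 0)) := by fun_prop
  have hexp : ∀ x : ℝ, |Real.exp (-(μ * max x 0))| ≤ 1 := fun x => by
    rw [abs_of_pos (Real.exp_pos _), Real.exp_le_one_iff]
    nlinarith [le_max_right x 0]
  have hs : ∫ ω, Real.exp (-(μ * max (S ω) 0)) ∂P = s := by
    refine integral_congr_ae ?_
    filter_upwards [hS] with ω hω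
    rw [max_eq_left hω]
  have hint : Integrable (fun ω => Real.exp (-(μ * max (S ω) 0))) P :=
    Integrable.of_bound (hmeas.comp_aemeasurable hSi.aemeasurable).aestronglyMeasurable 1
      (ae_of_all _ fun ω => hexp _)
  -- Stability is used here: `s ≥ 1 - μ * E S = 1 - ρ * (1 - z) > z`, where `ρ = lam * E S < 1`.
  have hsz : z < s := by
    have h1 : 1 - μ * ∫ ω, S ω ∂P ≤ s := by
      rw [← hs, ← integral_const_mul]
      have : ∫ ω, (1 - μ * S ω) ∂P = 1 - ∫ ω, μ * S ω ∂P := by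
        rw [integral_sub (integrable_const _) (hSi.const_mul μ)]; simp
      rw [← this]
      refine integral_mono_ae ((integrable_const _).sub (hSi.const_mul μ)) hint ?_
      filter_upwards [hS] with ω hω
      simp only [max_eq_left hω]
      linarith [Real.add_one_le_exp (-(μ * S ω))]
    nlinarith
  -- The boundary condition for `C * exp (-μ x) - 1 / μ` reads `C * (s - z) = (1 - z) / μ = 1 /
  -- lam`, which determines `C`.
  set C := 1 / (lam * (s - z)) with hC_def
  have hC : 0 < C := div_pos one_pos (mul_pos hlam (by linarith))
  have hCs : lam * C * (s - z) = 1 := by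
    have : s - z ≠ 0 := by linarith
    rw [hC_def]; field_simp
  have hbd : ∫ ω, (C * Real.exp (-(μ * max (S ω) 0)) - 1 / μ) ∂P
      = z * (C * Real.exp (-(μ * max 0 0)) - 1 / μ) := by
    rw [integral_sub (hint.const_mul C) (integrable_const _), integral_const_mul, hs]
    simp only [integral_const, probReal_univ, max_self, mul_zero, neg_zero, Real.exp_zero,
      smul_eq_mul, one_mul, mul_one]
    have : lam * (C * s - 1 / μ) = lam * (z * (C - 1 / μ)) := by
      have h1 : lam * (1 / μ) * (1 - z) = 1 := by
        rw [hμ_def]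
        have : 1 - z ≠ 0 := by linarith
        field_simp
      linear_combination hCs - h1
    exact mul_left_cancel₀ hlam.ne' this
  have hC1 : ∀ {a b : ℝ}, |a| ≤ b → |C * a| ≤ C * b := fun {a b} h => by
    rw [abs_mul, abs_of_pos hC]; gcongr
  have hK1 : 0 < C * μ := mul_pos hC hμ
  have hK2 : 0 < C * μ ^ 2 := by positivity
  have hK3 : 0 < 1 / μ := by positivity
  -- The truncation `max x 0` keeps `φ` bounded and Lipschitz on the whole line. `K` adds up the
  -- constants for the bounds on `φ` and `ψ`, the Lipschitz estimate and the Taylor estimate.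
  have hb := hq.balance heq hlam hS (K := C + 1 / μ + C * μ + C * μ ^ 2) hz0.le hz1.le
    (c := (∫ ω, S ω ∂P)⁻¹) (fun h hh => hN.integral_lt_le hSi hpos hh)
    (φ := fun x => C * Real.exp (-(μ * max x 0)) - 1 / μ)
    (ψ := fun x => -(C * (μ * Real.exp (-(μ * max x 0)))))
    ((hmeas.const_mul C).sub_const _) ((hmeas.const_mul μ).const_mul C).neg
    (fun x => by
      refine (abs_sub _ _).trans ?_
      have := hC1 (hexp x)
      rw [abs_of_pos hK3]
      linarith)
    (fun x => by
      rw [abs_neg, ← mul_assoc, abs_mul, abs_of_pos hK1]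
      nlinarith [hexp x])
    (fun x y => by
      rw [sub_sub_sub_cancel_right, ← mul_sub]
      have := hC1 (abs_exp_neg_max_sub_le hμ x y)
      nlinarith [abs_nonneg (x - y)])
    (fun h x hh hx => by
      have := hC1 (abs_exp_neg_max_taylor_le hμ hh hx)
      rw [show C * Real.exp (-(μ * max (x - h) 0)) - 1 / μ - (C * Real.exp (-(μ * max x 0)) - 1 / μ)
        + h * -(C * (μ * Real.exp (-(μ * max x 0)))) = C * (Real.exp (-(μ * max (x - h) 0))
          - Real.exp (-(μ * max x 0)) - h * (μ * Real.exp (-(μ * max x 0)))) by ring]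
      nlinarith [sq_nonneg h])
    hbd
  simp only [max_self, mul_zero, neg_zero, Real.exp_zero, mul_one] at hb
  have hzN : ∀ {f : ℝ → ℝ}, Measurable f → (∃ K, ∀ x, |f x| ≤ K) →
      Integrable (fun ω => if 0 < N₀ ω then z ^ N₀ ω * f (R₀ ω) else 0) P := by
    rintro f hf ⟨K, hK⟩
    have hK0 : 0 ≤ K := (abs_nonneg _).trans (hK 0)
    have hm : Measurable fun x : ℕ × ℝ => if 0 < x.1 then z ^ x.1 * f x.2 else 0 :=
      Measurable.ite (measurableSet_lt measurable_const measurable_fst)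
        (((measurable_from_nat (f := fun n => z ^ n)).comp measurable_fst).mul
          (hf.comp measurable_snd)) measurable_const
    refine Integrable.of_bound (hm.comp hq.measurable_state).aestronglyMeasurable K
      (ae_of_all _ fun ω => ?_)
    split_ifs
    · exact SingleServer.abs_mul_le_of_le_one (pow_nonneg hz0.le _) (pow_le_one₀ hz0.le hz1.le)
        (hK _)
    · simpa
  -- Since `ψ + μ * φ = -1`, the residual service time drops out of the balance equation.
  have hI : (∫ ω, (if 0 < N₀ ω then z ^ N₀ ω * -(C * (μ * Real.exp (-(μ * max (R₀ ω) 0))))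
        else 0) ∂P)
      + μ * (∫ ω, (if 0 < N₀ ω then z ^ N₀ ω * (C * Real.exp (-(μ * max (R₀ ω) 0)) - 1 / μ)
        else 0) ∂P) = -∫ ω, (if 0 < N₀ ω then z ^ N₀ ω * 1 else 0) ∂P := by
    rw [← integral_const_mul, ← integral_add, ← integral_neg]
    · refine integral_congr_ae (ae_of_all _ fun ω => ?_)
      simp only
      split_ifs
      · field_simp
        ring
      · simp
    · refine hzN (f := fun x => -(C * (μ * Real.exp (-(μ * max x 0))))) (by fun_prop) ⟨C * μ, ?_⟩
      intro x
      rw [abs_neg, ← mul_assoc, abs_mul, abs_of_pos hK1]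
      nlinarith [hexp x]
    · refine (hzN (f := fun x => C * Real.exp (-(μ * max x 0)) - 1 / μ) (by fun_prop)
        ⟨C + 1 / μ, ?_⟩).const_mul μ
      intro x
      refine (abs_sub _ _).trans ?_
      have := hC1 (hexp x)
      rw [abs_of_pos hK3]
      linarith
  have hE : Integrable (fun ω => (if N₀ ω = 0 then 1 else 0 : ℝ)) P :=
    Integrable.of_bound ((measurable_from_nat
      (f := fun n => (if n = 0 then 1 else 0 : ℝ))).comp hq.measurable_number).aestronglyMeasurable
      1 (ae_of_all _ fun ω => by split_ifs <;> simp)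
  have hsplit : ∫ ω, z ^ N₀ ω ∂P = (∫ ω, (if N₀ ω = 0 then 1 else 0 : ℝ) ∂P)
      + ∫ ω, (if 0 < N₀ ω then z ^ N₀ ω * 1 else 0) ∂P := by
    rw [← integral_add hE (hzN (f := fun _ => 1) measurable_const ⟨1, by simp⟩)]
    refine integral_congr_ae (ae_of_all _ fun ω => ?_)
    rcases Nat.eq_zero_or_pos (N₀ ω) with h | h
    · simp [h]
    · simp [h, h.ne']
  rw [hsplit]
  generalize (∫ ω, (if N₀ ω = 0 then 1 else 0 : ℝ) ∂P) = p at *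
  generalize (∫ ω, (if 0 < N₀ ω then z ^ N₀ ω * 1 else 0) ∂P) = G at *
  have hG : G = p * z * (μ * C - 1) := by
    have h1 : μ * (1 / μ) = 1 := by field_simp
    have h2 : -G = z * (p * (lam * (z * (C - 1 / μ) - (C - 1 / μ)))) := by
      rw [← hI, ← hb, hμ_def]; ring
    have h3 : z * (p * (lam * (z * (C - 1 / μ) - (C - 1 / μ)))) = - (p * z * (μ * C - μ * (1 / μ)))
      := by rw [hμ_def]; ring
    rw [h1] at h3
    linarith
  rw [hG, hμ_def]
  linear_combination p * z * (1 - z) * hCs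

end IsMG1Queue

/-! ### Poisson masses and iterated tails -/

/-- The probability that a Poisson variable with mean `y` equals `n`. -/
def poissonMass (n : ℕ) (y : ℝ) : ℝ := Real.exp (-y) * (y ^ n / n.factorial)

/-- The probability that a Poisson variable with mean `y` is at least `n`. -/
def poissonTail : ℕ → ℝ → ℝ
  | 0, _ => 1
  | n + 1, y => poissonTail n y - poissonMass n y

/-- The sum of `poissonTail k y` over `k > n`. -/
def poissonTail₂ : ℕ → ℝ → ℝ
  | 0, y => y
  | n + 1, y => poissonTail₂ n y - poissonTail (n + 1) y

/-- The sum of `poissonTail₂ k y` over `k > n`. -/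
def poissonTail₃ : ℕ → ℝ → ℝ
  | 0, y => y ^ 2 / 2
  | n + 1, y => poissonTail₃ n y - poissonTail₂ (n + 1) y

lemma hasDerivAt_pow_div_factorial (n : ℕ) (y : ℝ) :
    HasDerivAt (fun y : ℝ => y ^ (n + 1) / (n + 1).factorial) (y ^ n / n.factorial) y := by
  have h := (hasDerivAt_pow (n + 1) y).div_const ((n + 1).factorial : ℝ)
  convert! h using 1
  rw [Nat.factorial_succ]
  have : (n.factorial : ℝ) ≠ 0 := by positivity
  push_cast
  field_simp

lemma hasDerivAt_poissonMass_zero (y : ℝ) :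
    HasDerivAt (poissonMass 0) (-poissonMass 0 y) y := by
  have h := (hasDerivAt_neg y).exp
  convert! h using 1
  · ext y; simp [poissonMass]
  · simp [poissonMass]

lemma hasDerivAt_poissonMass_succ (n : ℕ) (y : ℝ) :
    HasDerivAt (poissonMass (n + 1)) (poissonMass n y - poissonMass (n + 1) y) y := by
  have h := (hasDerivAt_neg y).exp.mul (hasDerivAt_pow_div_factorial n y)
  convert! h using 1
  simp only [poissonMass]
  ring

lemma hasDerivAt_poissonTail_succ (n : ℕ) (y : ℝ) :
    HasDerivAt (poissonTail (n + 1)) (poissonMass n y) y := by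
  induction n with
  | zero =>
    have h := (hasDerivAt_poissonMass_zero y).const_sub 1
    rw [neg_neg] at h
    exact h
  | succ n ih =>
    have h := ih.sub (hasDerivAt_poissonMass_succ n y)
    rw [sub_sub_cancel] at h
    exact h

lemma hasDerivAt_poissonTail₂ (n : ℕ) (y : ℝ) :
    HasDerivAt (poissonTail₂ n) (poissonTail n y) y := by
  induction n with
  | zero => exact hasDerivAt_id y
  | succ n ih => exact ih.sub (hasDerivAt_poissonTail_succ n y)

lemma hasDerivAt_poissonTail₃ (n : ℕ) (y : ℝ) :
    HasDerivAt (poissonTail₃ n) (poissonTail₂ n y) y := by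
  induction n with
  | zero =>
    have h := (hasDerivAt_pow 2 y).div_const 2
    simpa [poissonTail₂, poissonTail₃] using h
  | succ n ih => exact ih.sub (hasDerivAt_poissonTail₂ (n + 1) y)

lemma poissonTail_succ_zero (n : ℕ) : poissonTail (n + 1) 0 = 0 := by
  induction n with
  | zero => simp [poissonTail, poissonMass]
  | succ n ih => rw [poissonTail, ih]; simp [poissonMass]

lemma poissonTail₂_zero (n : ℕ) : poissonTail₂ n 0 = 0 := by
  induction n with
  | zero => rfl
  | succ n ih => rw [poissonTail₂, ih, poissonTail_succ_zero, sub_zero]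

lemma poissonTail₃_zero (n : ℕ) : poissonTail₃ n 0 = 0 := by
  induction n with
  | zero => simp [poissonTail₃]
  | succ n ih => rw [poissonTail₃, ih, poissonTail₂_zero, sub_zero]

lemma le_of_hasDerivAt_le {f g f' g' : ℝ → ℝ} (hf : ∀ y, HasDerivAt f (f' y) y)
    (hg : ∀ y, HasDerivAt g (g' y) y) (h0 : f 0 ≤ g 0) (hle : ∀ y, 0 ≤ y → f' y ≤ g' y)
    {y : ℝ} (hy : 0 ≤ y) : f y ≤ g y := by
  have hd : ∀ y, HasDerivAt (fun y => g y - f y) (g' y - f' y) y := fun y => (hg y).sub (hf y)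
  have hm : MonotoneOn (fun y => g y - f y) (Set.Ici 0) := by
    refine monotoneOn_of_deriv_nonneg (convex_Ici 0)
      (fun x _ => (hd x).continuousAt.continuousWithinAt)
      (fun x _ => (hd x).differentiableAt.differentiableWithinAt) fun x hx => ?_
    rw [(hd x).deriv]
    rw [interior_Ici] at hx
    exact sub_nonneg.2 (hle x (le_of_lt hx))
  have := hm (Set.mem_Ici.2 le_rfl) (Set.mem_Ici.2 hy) hy
  simp only at this
  linarith

lemma poissonMass_nonneg (n : ℕ) {y : ℝ} (hy : 0 ≤ y) : 0 ≤ poissonMass n y := by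
  unfold poissonMass; positivity

lemma poissonMass_le (n : ℕ) {y : ℝ} (hy : 0 ≤ y) : poissonMass n y ≤ y ^ n / n.factorial :=
  mul_le_of_le_one_left (by positivity) (Real.exp_le_one_iff.2 (by linarith))

/-- Both bounds follow by comparing derivatives on `[0, ∞)`. The upper one makes the tails vanish as
`n → ∞`, which the telescoping sums need. -/
lemma poissonTail_mem (n : ℕ) {y : ℝ} (hy : 0 ≤ y) :
    0 ≤ poissonTail n y ∧ poissonTail n y ≤ y ^ n / n.factorial := by
  cases n with
  | zero => simp [poissonTail]
  | succ n =>
    exact ⟨le_of_hasDerivAt_le (fun y => hasDerivAt_const y (0 : ℝ))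
        (hasDerivAt_poissonTail_succ n) (poissonTail_succ_zero n).ge
        (fun y hy => poissonMass_nonneg n hy) hy,
      le_of_hasDerivAt_le (hasDerivAt_poissonTail_succ n) (hasDerivAt_pow_div_factorial n)
        (by simp [poissonTail_succ_zero]) (fun y hy => poissonMass_le n hy) hy⟩

lemma poissonTail₂_mem (n : ℕ) {y : ℝ} (hy : 0 ≤ y) :
    0 ≤ poissonTail₂ n y ∧ poissonTail₂ n y ≤ y ^ (n + 1) / (n + 1).factorial :=
  ⟨le_of_hasDerivAt_le (fun y => hasDerivAt_const y (0 : ℝ))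
      (hasDerivAt_poissonTail₂ n) (poissonTail₂_zero n).ge
      (fun y hy => (poissonTail_mem n hy).1) hy,
    le_of_hasDerivAt_le (hasDerivAt_poissonTail₂ n) (hasDerivAt_pow_div_factorial n)
      (by simp [poissonTail₂_zero]) (fun y hy => (poissonTail_mem n hy).2) hy⟩

lemma poissonTail₃_mem (n : ℕ) {y : ℝ} (hy : 0 ≤ y) :
    0 ≤ poissonTail₃ n y ∧ poissonTail₃ n y ≤ y ^ (n + 2) / (n + 2).factorial :=
  ⟨le_of_hasDerivAt_le (fun y => hasDerivAt_const y (0 : ℝ))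
      (hasDerivAt_poissonTail₃ n) (poissonTail₃_zero n).ge
      (fun y hy => (poissonTail₂_mem n hy).1) hy,
    le_of_hasDerivAt_le (hasDerivAt_poissonTail₃ n) (hasDerivAt_pow_div_factorial (n + 1))
      (by simp [poissonTail₃_zero]) (fun y hy => (poissonTail₂_mem n hy).2) hy⟩

lemma poissonTail_le_one (n : ℕ) {y : ℝ} (hy : 0 ≤ y) : poissonTail n y ≤ 1 := by
  induction n with
  | zero => exact le_rfl
  | succ n ih => exact (sub_le_self _ (poissonMass_nonneg n hy)).trans ih

lemma poissonTail₂_le (n : ℕ) {y : ℝ} (hy : 0 ≤ y) : poissonTail₂ n y ≤ y := by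
  induction n with
  | zero => exact le_rfl
  | succ n ih => exact (sub_le_self _ (poissonTail_mem (n + 1) hy).1).trans ih

lemma poissonMass_le_one (n : ℕ) {y : ℝ} (hy : 0 ≤ y) : poissonMass n y ≤ 1 := by
  have h1 := (poissonTail_mem (n + 1) hy).1
  have h2 := poissonTail_le_one n hy
  rw [poissonTail] at h1
  linarith

/-- A telescoping series. -/
lemma hasSum_of_telescope {u c : ℕ → ℝ} (hc : ∀ n, 0 ≤ c n) (hu : ∀ n, u (n + 1) = u n - c n)
    (h0 : Tendsto u atTop (𝓝 0)) : HasSum c (u 0) := by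
  rw [hasSum_iff_tendsto_nat_of_nonneg hc]
  have hs : ∀ N, ∑ k ∈ Finset.range N, c k = u 0 - u N := by
    intro N
    induction N with
    | zero => simp
    | succ N ih => rw [Finset.sum_range_succ, ih, hu]; ring
  simp only [hs]
  simpa using h0.const_sub (u 0)

lemma tendsto_zero_of_le_pow_div_factorial {u : ℕ → ℝ} {y : ℝ} (j : ℕ)
    (hu : ∀ n, 0 ≤ u n ∧ u n ≤ y ^ (n + j) / (n + j).factorial) :
    Tendsto u atTop (𝓝 0) :=
  squeeze_zero (fun n => (hu n).1) (fun n => (hu n).2)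
    ((FloorSemiring.tendsto_pow_div_factorial_atTop y).comp (tendsto_add_atTop_nat j))

lemma hasSum_poissonMass {y : ℝ} (hy : 0 ≤ y) : HasSum (fun n => poissonMass n y) 1 :=
  hasSum_of_telescope (u := fun n => poissonTail n y) (fun n => poissonMass_nonneg n hy)
    (fun _ => rfl) (tendsto_zero_of_le_pow_div_factorial 0 fun n => poissonTail_mem n hy)

lemma hasSum_poissonTail {y : ℝ} (hy : 0 ≤ y) : HasSum (fun n => poissonTail (n + 1) y) y :=
  hasSum_of_telescope (u := fun n => poissonTail₂ n y) (fun _ => (poissonTail_mem _ hy).1)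
    (fun _ => rfl) (tendsto_zero_of_le_pow_div_factorial 1 fun n => poissonTail₂_mem n hy)

lemma hasSum_poissonTail₂ {y : ℝ} (hy : 0 ≤ y) :
    HasSum (fun n => poissonTail₂ (n + 1) y) (y ^ 2 / 2) :=
  hasSum_of_telescope (u := fun n => poissonTail₃ n y) (fun _ => (poissonTail₂_mem _ hy).1)
    (fun _ => rfl) (tendsto_zero_of_le_pow_div_factorial 2 fun n => poissonTail₃_mem n hy)

lemma hasSum_poissonMass_mul_pow (y z : ℝ) :
    HasSum (fun n => poissonMass n y * z ^ n) (Real.exp (-((1 - z) * y))) := by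
  have h := (NormedSpace.expSeries_div_hasSum_exp (𝔸 := ℝ) (y * z)).mul_left (Real.exp (-y))
  rw [← Real.exp_eq_exp_ℝ, ← Real.exp_add] at h
  convert! h using 1
  · ext n; rw [poissonMass, mul_pow]; ring
  · ring_nf

lemma continuous_poissonMass (n : ℕ) : Continuous (poissonMass n) := by
  unfold poissonMass; fun_prop

lemma continuous_poissonTail (n : ℕ) : Continuous (poissonTail n) := by
  induction n with
  | zero => exact continuous_const
  | succ n ih => exact ih.sub (continuous_poissonMass n)

lemma continuous_poissonTail₂ (n : ℕ) : Continuous (poissonTail₂ n) := by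
  induction n with
  | zero => exact continuous_id
  | succ n ih => exact ih.sub (continuous_poissonTail _)

/-! ### NBUE under Poisson mixing -/

/-- For a law on `[0, ∞)` that is new better than used in expectation, the expectation of an
iterated primitive is at most the mean times the expectation of the primitive. -/
lemma lintegral_iterated_primitive_le {ν : Measure ℝ} [IsProbabilityMeasure ν] {m : ℝ}
    (hm : 0 ≤ m) (hν0 : ∀ᵐ x ∂ν, 0 ≤ x) (hνi : Integrable (fun x => x) ν)
    (hν : ∀ y, 0 ≤ y → ∫ x, max (x - y) 0 ∂ν ≤ m * ν.real (Set.Ici y))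
    {k : ℝ → ℝ} (hk : Continuous k) (hk0 : ∀ y, 0 ≤ y → 0 ≤ k y) :
    ∫⁻ x, ENNReal.ofReal (∫ y in (0 : ℝ)..x, k y * (x - y)) ∂ν
      ≤ ENNReal.ofReal m * ∫⁻ x, ENNReal.ofReal (∫ y in (0 : ℝ)..x, k y) ∂ν := by
  -- Writing the primitives as integrals over a fixed domain prepares for Tonelli. Extended
  -- nonnegative integrals are used because the second moment is not yet known to be finite.
  have hrepr : ∀ (g : ℝ → ℝ → ℝ), (∀ x, Continuous (g x)) → (∀ x y, y ≤ x → 0 ≤ g x y) →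
      ∀ x, 0 ≤ x → ENNReal.ofReal (∫ y in (0 : ℝ)..x, k y * g x y)
        = ∫⁻ y in Set.Ioi 0, ENNReal.ofReal (k y) * (Set.Iic x).indicator
          (fun y => ENNReal.ofReal (g x y)) y := by
    intro g hg hg0 x hx
    rw [intervalIntegral.integral_of_le hx, ofReal_integral_eq_lintegral_ofReal]
    · rw [← Set.Ioi_inter_Iic, Set.inter_comm, ← Measure.restrict_restrict measurableSet_Iic,
        ← lintegral_indicator measurableSet_Iic]
      refine setLIntegral_congr_fun measurableSet_Ioi fun y hy => ?_
      by_cases hyx : y ≤ x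
      · simp [Set.indicator, hyx, ENNReal.ofReal_mul (hk0 y (le_of_lt hy))]
      · simp [Set.indicator, hyx]
    · exact ((hk.mul (hg x)).integrableOn_Icc).mono_set Set.Ioc_subset_Icc_self
    · filter_upwards [ae_restrict_mem measurableSet_Ioc] with y hy
      exact mul_nonneg (hk0 y hy.1.le) (hg0 x y hy.2)
  have h1 := hrepr (fun x y => x - y) (fun x => by fun_prop) (fun x y h => sub_nonneg.2 h)
  have h2 := hrepr (fun _ _ => 1) (fun x => continuous_const) (fun _ _ _ => zero_le_one)
  simp only [mul_one] at h2
  have hkm : Measurable fun y => ENNReal.ofReal (k y) := hk.measurable.ennreal_ofReal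
  have hset : MeasurableSet {p : ℝ × ℝ | p.2 ≤ p.1} := measurableSet_le measurable_snd measurable_fst
  have hm1 : Measurable fun p : ℝ × ℝ => ENNReal.ofReal (k p.2) * (Set.Iic p.1).indicator
      (fun y => ENNReal.ofReal (p.1 - y)) p.2 := by
    refine (hkm.comp measurable_snd).mul ?_
    have : (fun p : ℝ × ℝ => (Set.Iic p.1).indicator (fun y => ENNReal.ofReal (p.1 - y)) p.2)
        = {p : ℝ × ℝ | p.2 ≤ p.1}.indicator fun p => ENNReal.ofReal (p.1 - p.2) := by
      ext p; simp [Set.indicator]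
    rw [this]
    exact (measurable_fst.sub measurable_snd).ennreal_ofReal.indicator hset
  have hm2 : Measurable fun p : ℝ × ℝ => ENNReal.ofReal (k p.2) * (Set.Iic p.1).indicator
      (fun _ => ENNReal.ofReal 1) p.2 := by
    refine (hkm.comp measurable_snd).mul ?_
    have : (fun p : ℝ × ℝ => (Set.Iic p.1).indicator (fun _ => ENNReal.ofReal 1) p.2)
        = {p : ℝ × ℝ | p.2 ≤ p.1}.indicator fun _ => ENNReal.ofReal 1 := by
      ext p; simp [Set.indicator]
    rw [this]
    exact measurable_const.indicator hset
  rw [lintegral_congr_ae (hν0.mono h1), lintegral_congr_ae (hν0.mono h2),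
    lintegral_lintegral_swap (f := fun x y => ENNReal.ofReal (k y) * (Set.Iic x).indicator
      (fun y => ENNReal.ofReal (x - y)) y) hm1.aemeasurable,
    lintegral_lintegral_swap (f := fun x y => ENNReal.ofReal (k y) * (Set.Iic x).indicator
      (fun _ => ENNReal.ofReal 1) y) hm2.aemeasurable,
    ← lintegral_const_mul' _ _ ENNReal.ofReal_ne_top]
  -- After the interchange it suffices to compare `E (x - y)⁺` with `m * P(x ≥ y)` for each `y`,
  -- which is the NBUE inequality.
  refine setLIntegral_mono' measurableSet_Ioi fun y hy => ?_
  rw [lintegral_const_mul' _ _ ENNReal.ofReal_ne_top,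
    lintegral_const_mul' _ _ ENNReal.ofReal_ne_top, mul_left_comm]
  gcongr
  have e1 : ∫⁻ x, (Set.Iic x).indicator (fun y => ENNReal.ofReal (x - y)) y ∂ν
      = ENNReal.ofReal (∫ x, max (x - y) 0 ∂ν) := by
    have hpi : Integrable (fun x => max (x - y) 0) ν := (hνi.sub (integrable_const y)).pos_part
    rw [ofReal_integral_eq_lintegral_ofReal hpi (ae_of_all _ fun x => le_max_right _ _)]
    refine lintegral_congr fun x => ?_
    by_cases h : y ≤ x
    · simp [Set.indicator, h]
    · simp [Set.indicator, h, (not_le.1 h).le]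
  have e2 : ∫⁻ x, (Set.Iic x).indicator (fun _ => ENNReal.ofReal 1) y ∂ν
      = ENNReal.ofReal (ν.real (Set.Ici y)) := by
    rw [measureReal_def, ENNReal.ofReal_toReal (measure_ne_top _ _),
      ← lintegral_indicator_one measurableSet_Ici]
    refine lintegral_congr fun x => ?_
    simp [Set.indicator]
  rw [e1, e2, ← ENNReal.ofReal_mul hm]
  exact ENNReal.ofReal_le_ofReal (hν y (le_of_lt hy))

section MixedPoisson

variable {ν : Measure ℝ} [IsProbabilityMeasure ν]

lemma integral_poissonMass_primitive (n : ℕ) (x : ℝ) :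
    ∫ y in (0 : ℝ)..x, poissonMass n y = poissonTail (n + 1) x := by
  rw [intervalIntegral.integral_eq_sub_of_hasDerivAt
    (fun y _ => hasDerivAt_poissonTail_succ n y)
    ((continuous_poissonMass n).intervalIntegrable _ _), poissonTail_succ_zero, sub_zero]

/-- Differentiating an iterated tail gives the preceding one, so the iterated primitive of the mass
is again a tail. With the kernel `poissonMass n`, the primitive inequality thus becomes discrete
NBUE. -/
lemma integral_poissonMass_mul_sub (n : ℕ) (x : ℝ) :
    ∫ y in (0 : ℝ)..x, poissonMass n y * (x - y) = poissonTail₂ (n + 1) x := by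
  have hd : ∀ y, HasDerivAt (fun y => poissonTail (n + 1) y * (x - y) + poissonTail₂ (n + 1) y)
      (poissonMass n y * (x - y)) y := fun y => by
    have h := ((hasDerivAt_poissonTail_succ n y).mul ((hasDerivAt_id y).const_sub x)).add
      (hasDerivAt_poissonTail₂ (n + 1) y)
    convert! h using 1
    simp
  rw [intervalIntegral.integral_eq_sub_of_hasDerivAt (fun y _ => hd y)
    (((continuous_poissonMass n).mul (by fun_prop)).intervalIntegrable _ _),
    poissonTail_succ_zero, poissonTail₂_zero]
  simp

lemma integrable_poissonMass (hν0 : ∀ᵐ x ∂ν, 0 ≤ x) (n : ℕ) : Integrable (poissonMass n) ν :=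
  Integrable.of_bound (continuous_poissonMass n).aestronglyMeasurable 1
    (hν0.mono fun x hx => by
      rw [Real.norm_of_nonneg (poissonMass_nonneg n hx)]; exact poissonMass_le_one n hx)

lemma integrable_poissonTail (hν0 : ∀ᵐ x ∂ν, 0 ≤ x) (n : ℕ) : Integrable (poissonTail n) ν :=
  Integrable.of_bound (continuous_poissonTail n).aestronglyMeasurable 1
    (hν0.mono fun x hx => by
      rw [Real.norm_of_nonneg (poissonTail_mem n hx).1]; exact poissonTail_le_one n hx)

omit [IsProbabilityMeasure ν] in
lemma integrable_poissonTail₂ (hν0 : ∀ᵐ x ∂ν, 0 ≤ x) (hνi : Integrable (fun x => x) ν) (n : ℕ) :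
    Integrable (poissonTail₂ n) ν :=
  hνi.mono' (continuous_poissonTail₂ n).aestronglyMeasurable
    (hν0.mono fun x hx => by
      rw [Real.norm_of_nonneg (poissonTail₂_mem n hx).1]; exact poissonTail₂_le n hx)

/-- A law on `[0, ∞)` that is new better than used in expectation has a second moment. -/
lemma integrable_sq_of_nbue {m : ℝ} (hm : 0 ≤ m) (hν0 : ∀ᵐ x ∂ν, 0 ≤ x)
    (hνi : Integrable (fun x => x) ν)
    (hν : ∀ y, 0 ≤ y → ∫ x, max (x - y) 0 ∂ν ≤ m * ν.real (Set.Ici y)) :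
    Integrable (fun x : ℝ => x ^ 2) ν := by
  -- The kernel `1` has primitive `x` and iterated primitive `x ^ 2 / 2`, so the second moment is
  -- controlled by the first.
  have h := lintegral_iterated_primitive_le hm hν0 hνi hν (k := fun _ => 1) continuous_const
    (fun _ _ => zero_le_one)
  have e1 : ∀ x : ℝ, ∫ y in (0 : ℝ)..x, 1 * (x - y) = x ^ 2 / 2 := fun x => by
    have hd : ∀ y, HasDerivAt (fun y : ℝ => -((x - y) ^ 2 / 2)) (1 * (x - y)) y := fun y => by
      have h := ((((hasDerivAt_id y).const_sub x).fun_pow 2).div_const 2).fun_neg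
      convert! h using 1
      simp
      ring
    rw [intervalIntegral.integral_eq_sub_of_hasDerivAt (fun y _ => hd y)
      (Continuous.intervalIntegrable (by fun_prop) _ _)]
    simp
  simp only [e1, intervalIntegral.integral_const, sub_zero, smul_eq_mul, mul_one] at h
  have hfin : ∫⁻ x, ENNReal.ofReal (x ^ 2 / 2) ∂ν < ⊤ := by
    refine h.trans_lt (ENNReal.mul_lt_top ENNReal.ofReal_lt_top ?_)
    exact hνi.lintegral_lt_top
  have : Integrable (fun x : ℝ => x ^ 2 / 2) ν := by
    refine (lintegral_ofReal_ne_top_iff_integrable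
      (by fun_prop : Continuous fun x : ℝ => x ^ 2 / 2).aestronglyMeasurable
      (ae_of_all _ fun x => by positivity)).1 hfin.ne
  simpa using this.mul_const 2

/-- Poisson mixtures preserve the property of being new better than used in expectation. -/
lemma integral_poissonTail₂_le {m : ℝ} (hm : m = ∫ x, x ∂ν) (hm0 : 0 ≤ m)
    (hν0 : ∀ᵐ x ∂ν, 0 ≤ x) (hνi : Integrable (fun x => x) ν)
    (hν : ∀ y, 0 ≤ y → ∫ x, max (x - y) 0 ∂ν ≤ m * ν.real (Set.Ici y)) (n : ℕ) :
    ∫ x, poissonTail₂ n x ∂ν ≤ m * ∫ x, poissonTail n x ∂ν := by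
  cases n with
  | zero => simp [poissonTail, poissonTail₂, hm]
  | succ n =>
    have h := lintegral_iterated_primitive_le hm0 hν0 hνi hν (continuous_poissonMass n)
      (fun y hy => poissonMass_nonneg n hy)
    simp only [integral_poissonMass_primitive, integral_poissonMass_mul_sub] at h
    rw [← ofReal_integral_eq_lintegral_ofReal (integrable_poissonTail hν0 _)
        (hν0.mono fun x hx => (poissonTail_mem _ hx).1),
      ← ofReal_integral_eq_lintegral_ofReal (integrable_poissonTail₂ hν0 hνi _)
        (hν0.mono fun x hx => (poissonTail₂_mem _ hx).1), ← ENNReal.ofReal_mul hm0] at h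
    refine (ENNReal.ofReal_le_ofReal_iff (mul_nonneg hm0 (integral_nonneg_of_ae ?_))).1 h
    exact hν0.mono fun x hx => (poissonTail_mem _ hx).1

omit [IsProbabilityMeasure ν] in
-- Nonnegative terms dominate themselves, so integrability of the sum is all that the interchange
-- requires.
lemma hasSum_integral_of_nonneg {F : ℕ → ℝ → ℝ} {f : ℝ → ℝ} (hν0 : ∀ᵐ x ∂ν, 0 ≤ x)
    (hF : ∀ n, Continuous (F n)) (hF0 : ∀ n x, 0 ≤ x → 0 ≤ F n x)
    (hs : ∀ x, 0 ≤ x → HasSum (fun n => F n x) (f x)) (hf : Integrable f ν) :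
    HasSum (fun n => ∫ x, F n x ∂ν) (∫ x, f x ∂ν) := by
  refine hasSum_integral_of_dominated_convergence F (fun n => (hF n).aestronglyMeasurable)
    (fun n => hν0.mono fun x hx => (Real.norm_of_nonneg (hF0 n x hx)).le)
    (hν0.mono fun x hx => (hs x hx).summable) (hf.congr (hν0.mono fun x hx => ?_))
    (hν0.mono hs)
  exact (hs x hx).tsum_eq.symm

lemma hasSum_integral_poissonMass (hν0 : ∀ᵐ x ∂ν, 0 ≤ x) :
    HasSum (fun n => ∫ x, poissonMass n x ∂ν) 1 := by
  simpa using hasSum_integral_of_nonneg hν0 continuous_poissonMass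
    (fun n x hx => poissonMass_nonneg n hx) (fun x hx => hasSum_poissonMass hx)
    (integrable_const 1)

lemma hasSum_integral_poissonMass_mul_pow (hν0 : ∀ᵐ x ∂ν, 0 ≤ x) {z : ℝ} (hz0 : 0 ≤ z)
    (hz1 : z ≤ 1) :
    HasSum (fun n => (∫ x, poissonMass n x ∂ν) * z ^ n) (∫ x, Real.exp (-((1 - z) * x)) ∂ν) := by
  simp only [← integral_mul_const]
  refine hasSum_integral_of_nonneg hν0 (fun n => (continuous_poissonMass n).mul continuous_const)
    (fun n x hx => mul_nonneg (poissonMass_nonneg n hx) (pow_nonneg hz0 n))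
    (fun x _ => hasSum_poissonMass_mul_pow x z) ?_
  refine Integrable.of_bound (by fun_prop) 1 (hν0.mono fun x hx => ?_)
  rw [Real.norm_of_nonneg (Real.exp_pos _).le, Real.exp_le_one_iff]
  nlinarith

omit [IsProbabilityMeasure ν] in
lemma hasSum_integral_poissonTail (hν0 : ∀ᵐ x ∂ν, 0 ≤ x) (hνi : Integrable (fun x => x) ν) :
    HasSum (fun n => ∫ x, poissonTail (n + 1) x ∂ν) (∫ x, x ∂ν) :=
  hasSum_integral_of_nonneg hν0 (fun _ => continuous_poissonTail _)
    (fun _ _ hx => (poissonTail_mem _ hx).1) (fun _ hx => hasSum_poissonTail hx) hνi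

omit [IsProbabilityMeasure ν] in
lemma hasSum_integral_poissonTail₂ (hν0 : ∀ᵐ x ∂ν, 0 ≤ x)
    (hνi : Integrable (fun x : ℝ => x ^ 2) ν) :
    HasSum (fun n => ∫ x, poissonTail₂ (n + 1) x ∂ν) ((∫ x, x ^ 2 ∂ν) / 2) := by
  rw [← integral_div]
  exact hasSum_integral_of_nonneg hν0 (fun _ => continuous_poissonTail₂ _)
    (fun _ _ hx => (poissonTail₂_mem _ hx).1) (fun _ hx => hasSum_poissonTail₂ hx)
    (hνi.div_const 2)

lemma integral_poissonTail_succ (hν0 : ∀ᵐ x ∂ν, 0 ≤ x) (n : ℕ) :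
    ∫ x, poissonTail (n + 1) x ∂ν = (∫ x, poissonTail n x ∂ν) - ∫ x, poissonMass n x ∂ν :=
  integral_sub (integrable_poissonTail hν0 n) (integrable_poissonMass hν0 n)

lemma integral_poissonTail₂_succ (hν0 : ∀ᵐ x ∂ν, 0 ≤ x) (hνi : Integrable (fun x => x) ν) (n : ℕ) :
    ∫ x, poissonTail₂ (n + 1) x ∂ν
      = (∫ x, poissonTail₂ n x ∂ν) - ∫ x, poissonTail (n + 1) x ∂ν :=
  integral_sub (integrable_poissonTail₂ hν0 hνi n) (integrable_poissonTail hν0 (n + 1))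

end MixedPoisson

/-! ### Power series and their values -/

namespace PowerSeries

/-- The power series `F` converges absolutely at `z` with sum `v`. -/
def HasVal (F : PowerSeries ℝ) (z v : ℝ) : Prop :=
  (Summable fun n => ‖coeff n F * z ^ n‖) ∧ HasSum (fun n => coeff n F * z ^ n) v

variable {F G : PowerSeries ℝ} {z u v : ℝ}

lemma HasVal.unique (hF : F.HasVal z u) (hG : F.HasVal z v) : u = v := hF.2.unique hG.2

lemma HasVal.sub (hF : F.HasVal z u) (hG : G.HasVal z v) : (F - G).HasVal z (u - v) := by
  have e : (fun n => coeff n (F - G) * z ^ n)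
      = fun n => coeff n F * z ^ n - coeff n G * z ^ n := by
    ext n; rw [map_sub, sub_mul]
  refine ⟨?_, by rw [e]; exact hF.2.sub hG.2⟩
  refine Summable.of_nonneg_of_le (fun n => norm_nonneg _) (fun n => ?_) (hF.1.add hG.1)
  rw [map_sub, sub_mul]
  exact norm_sub_le _ _

lemma HasVal.mul (hF : F.HasVal z u) (hG : G.HasVal z v) : (F * G).HasVal z (u * v) := by
  have e : (fun n => coeff n (F * G) * z ^ n) = fun n =>
      ∑ kl ∈ Finset.HasAntidiagonal.antidiagonal n, (coeff kl.1 F * z ^ kl.1) * (coeff kl.2 G * z ^ kl.2) := by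
    ext n
    rw [coeff_mul, Finset.sum_mul]
    refine Finset.sum_congr rfl fun kl hkl => ?_
    rw [← Finset.HasAntidiagonal.mem_antidiagonal.1 hkl, pow_add]
    ring
  have h1 := summable_norm_sum_mul_antidiagonal_of_summable_norm hF.1 hG.1
  have h2 := tsum_mul_tsum_eq_tsum_sum_antidiagonal_of_summable_norm hF.1 hG.1
  unfold HasVal
  rw [hF.2.tsum_eq, hG.2.tsum_eq] at h2
  refine ⟨?_, ?_⟩
  · rw [funext fun n => congrArg norm (congrFun e n)]
    exact h1
  · rw [e, h2]
    exact h1.of_norm.hasSum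

lemma hasVal_C (a z : ℝ) : (C a : PowerSeries ℝ).HasVal z a := by
  have h : ∀ n, n ≠ 0 → coeff n (C a : PowerSeries ℝ) * z ^ n = 0 := fun n hn => by
    rw [coeff_C, if_neg hn, zero_mul]
  refine ⟨(hasSum_single 0 fun n hn => by rw [h n hn, norm_zero]).summable, ?_⟩
  simpa using hasSum_single 0 h

lemma hasVal_one (z : ℝ) : (1 : PowerSeries ℝ).HasVal z 1 := by
  simpa using hasVal_C 1 z

lemma hasVal_X (z : ℝ) : (X : PowerSeries ℝ).HasVal z z := by
  have h : ∀ n, n ≠ 1 → coeff n (X : PowerSeries ℝ) * z ^ n = 0 := fun n hn => by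
    rw [coeff_X, if_neg hn, zero_mul]
  refine ⟨(hasSum_single 1 fun n hn => by rw [h n hn, norm_zero]).summable, ?_⟩
  simpa using hasSum_single 1 h

lemma hasVal_mk_of_nonneg {f : ℕ → ℝ} (hf : ∀ n, 0 ≤ f n) (hz : 0 ≤ z)
    (h : HasSum (fun n => f n * z ^ n) v) : (mk f).HasVal z v := by
  refine ⟨?_, by simpa using h⟩
  refine h.summable.congr fun n => ?_
  rw [coeff_mk, Real.norm_of_nonneg (mul_nonneg (hf n) (pow_nonneg hz n))]

lemma hasVal_mk_one_of_nonneg {f : ℕ → ℝ} (hf : ∀ n, 0 ≤ f n) (h : HasSum f v) :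
    (mk f).HasVal 1 v :=
  hasVal_mk_of_nonneg hf zero_le_one (by simpa using h)

lemma HasVal.hasSum_coeff (h : F.HasVal 1 v) : HasSum (fun n => coeff n F) v := by
  simpa using h.2

/-- A power series that vanishes on `(0, 1)` is zero. -/
lemma eq_zero_of_hasVal (h : ∀ z, 0 < z → z < 1 → F.HasVal z 0) : F = 0 := by
  set p := FormalMultilinearSeries.ofScalars ℝ (fun n => coeff n F) with hp
  have hrad : ((1 / 2 : NNReal) : ENNReal) ≤ p.radius := by
    refine p.le_radius_of_summable_norm ?_
    refine (h (1 / 2) (by norm_num) (by norm_num)).1.congr fun n => ?_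
    rw [hp, FormalMultilinearSeries.ofScalars_norm, norm_mul]
    simp
  have hpos : 0 < p.radius := lt_of_lt_of_le (by norm_num) hrad
  -- Zeros in `(0, 1)` accumulate at `0`, so the identity theorem for analytic functions applies.
  have hfp := (p.hasFPowerSeriesOnBall hpos).hasFPowerSeriesAt
  have hfreq : ∃ᶠ z in 𝓝[≠] (0 : ℝ), p.sum z = 0 := by
    have h1 : ∃ᶠ z in 𝓝[>] (0 : ℝ), p.sum z = 0 := by
      refine Eventually.frequently ?_
      filter_upwards [self_mem_nhdsWithin, nhdsWithin_le_nhds (eventually_lt_nhds one_pos)]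
        with z hz hz1
      have := (h z hz hz1).2.tsum_eq
      refine (FormalMultilinearSeries.ofScalars_sum_eq (E := ℝ) (fun n => coeff n F) z).trans ?_
      simpa using this
    exact h1.filter_mono (nhdsWithin_mono 0 (fun x (hx : 0 < x) => hx.ne'))
  have hev := hfp.analyticAt.frequently_zero_iff_eventually_zero.1 hfreq
  have hp0 := hfp.eq_zero_of_eventually hev
  ext n
  exact congrFun ((FormalMultilinearSeries.ofScalars_series_eq_zero ℝ).1 hp0) n

end PowerSeries

namespace PowerSeries

lemma coeff_mul_nonneg {F G : PowerSeries ℝ} (hF : ∀ n, 0 ≤ coeff n F) (hG : ∀ n, 0 ≤ coeff n G)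
    (n : ℕ) : 0 ≤ coeff n (F * G) := by
  rw [coeff_mul]
  exact Finset.sum_nonneg fun _ _ => mul_nonneg (hF _) (hG _)

/-- The solution of the renewal equation `Q = u + R Q` has nonnegative coefficients. -/
lemma coeff_nonneg_of_renewal {Q R : PowerSeries ℝ} {u : ℝ} (hu : 0 ≤ u)
    (hR : ∀ n, 0 ≤ coeff n R) (hR0 : coeff 0 R < 1) (hQ : Q = C u + R * Q) (n : ℕ) :
    0 ≤ coeff n Q := by
  induction n using Nat.strong_induction_on with
  | _ n ih =>
    have h := congrArg (coeff n) hQ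
    -- Isolating the term `R₀ Qₙ` leaves `(1 - R₀) Qₙ` equal to a nonnegative expression in earlier
    -- coefficients of `Q`.
    have hmem : ((0 : ℕ), n) ∈ Finset.HasAntidiagonal.antidiagonal n := by simp
    rw [map_add, coeff_mul, ← Finset.add_sum_erase _ _ hmem] at h
    have h1 : 0 ≤ coeff n (C u : PowerSeries ℝ) := by
      rw [coeff_C]; split_ifs <;> simp [hu]
    have h2 : 0 ≤ ∑ x ∈ (Finset.HasAntidiagonal.antidiagonal n).erase (0, n),
        coeff x.1 R * coeff x.2 Q := by
      refine Finset.sum_nonneg fun x hx => mul_nonneg (hR _) (ih _ ?_)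
      rw [Finset.mem_erase, Finset.HasAntidiagonal.mem_antidiagonal] at hx
      obtain ⟨a, b⟩ := x
      simp only [ne_eq, Prod.mk.injEq, not_and] at hx
      have := hx.1
      have := hx.2
      simp only
      by_contra hb
      exact hx.1 (by omega) (by omega)
    simp only at h
    nlinarith

end PowerSeries

/-! ### Comparison with the geometric law by generating functions -/

open PowerSeries in
/-- If the generating function of `w` satisfies the Pollaczek–Khinchine formula for `a`, the law of
the number of arrivals in a service time, and if `a` is new better than used in expectation, then
`w` differs from the geometric law by a multiple of the difference of two measures of the same
small mass. -/
theorem sub_geometric_of_pollaczek_khinchine {w a ta tb : ℕ → ℝ} {ρ σ : ℝ}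
    (hρ0 : 0 < ρ) (hρ1 : ρ < 1) (hw0 : ∀ n, 0 ≤ w n) (hw : HasSum w 1)
    (ha0 : ∀ n, 0 ≤ a n) (ha : HasSum a 1) (hta0 : ta 0 = 1) (hta : ∀ n, ta (n + 1) = ta n - a n)
    (hta_nonneg : ∀ n, 0 ≤ ta n) (hta_sum : HasSum (fun n => ta (n + 1)) ρ)
    (htb0 : tb 0 = ρ) (htb : ∀ n, tb (n + 1) = tb n - ta (n + 1))
    (htb_le : ∀ n, tb n ≤ ρ * ta n) (htb_sum : HasSum (fun n => tb (n + 1)) σ)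
    (hpk : ∀ z, 0 < z → z < 1 → ∃ s g, HasSum (fun n => a n * z ^ n) s ∧
      HasSum (fun n => w n * z ^ n) g ∧ g * (s - z) = w 0 * (1 - z) * s) :
    ∃ U V : ℕ → ℝ, (∀ n, 0 ≤ U n) ∧ (∀ n, 0 ≤ V n) ∧ HasSum U (ρ - σ / ρ) ∧
      HasSum V (ρ - σ / ρ) ∧ ∀ n, w n - (1 - ρ) * ρ ^ n = ρ * (U n - V n) := by
  set W : PowerSeries ℝ := mk w with hW
  set A : PowerSeries ℝ := mk a with hA
  set R : PowerSeries ℝ := mk fun n => ta (n + 1) with hR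
  -- `B` is the equilibrium law of `a`, and the coefficients of `D` are the tails of `a` minus those
  -- of `B`.
  set B : PowerSeries ℝ := mk fun n => ta (n + 1) / ρ with hB
  set D : PowerSeries ℝ := mk fun n => ta (n + 1) - tb (n + 1) / ρ with hD
  set G : PowerSeries ℝ := mk fun n => (1 - ρ) * ρ ^ n with hG
  have hρ : ρ ≠ 0 := hρ0.ne'
  have hRB : R = C ρ * B := by
    ext n; rw [hR, hB, coeff_C_mul, coeff_mk, coeff_mk]; field_simp
  have hRA : R * (1 - X) = 1 - A := by
    rw [mul_sub, mul_one]
    ext n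
    cases n with
    | zero => simp [hR, hA, hta, hta0]
    | succ n =>
      rw [map_sub, coeff_succ_mul_X, map_sub, coeff_one, if_neg (by omega), hR, hA, coeff_mk,
        coeff_mk, coeff_mk, hta (n + 1)]
      ring
  have hBA : B - A = D * (1 - X) := by
    rw [mul_sub, mul_one]
    ext n
    cases n with
    | zero =>
      simp only [hB, hA, hD, map_sub, coeff_mk, coeff_zero_mul_X, htb, hta, hta0, htb0]
      field_simp
      ring
    | succ n =>
      rw [map_sub, map_sub, coeff_succ_mul_X, hB, hA, hD, coeff_mk, coeff_mk, coeff_mk,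
        coeff_mk, htb (n + 1), hta (n + 1)]
      field_simp
      ring
  have hG1 : G * (1 - C ρ * X) = C (1 - ρ) := by
    rw [mul_sub, mul_one, mul_left_comm]
    ext n
    cases n with
    | zero => simp [hG]
    | succ n =>
      rw [map_sub, coeff_C_mul, coeff_succ_mul_X, hG, coeff_mk, coeff_mk, coeff_C,
        if_neg (by omega)]
      ring
  have h1X : (1 - X : PowerSeries ℝ) ≠ 0 := fun h => by
    simpa using congrArg (coeff 0) h
  have hρX : (1 - C ρ * X : PowerSeries ℝ) ≠ 0 := fun h => by
    simpa using congrArg (coeff 0) h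
  have hpk' : W * (A - X) = C (w 0) * (1 - X) * A := by
    rw [← sub_eq_zero]
    refine eq_zero_of_hasVal fun z hz0 hz1 => ?_
    obtain ⟨s, g, hs, hg, h⟩ := hpk z hz0 hz1
    have vA := hasVal_mk_of_nonneg ha0 hz0.le hs
    have vW := hasVal_mk_of_nonneg hw0 hz0.le hg
    have := (vW.mul (vA.sub (hasVal_X z))).sub
      (((hasVal_C (w 0) z).mul ((hasVal_one z).sub (hasVal_X z))).mul vA)
    rwa [h, sub_self] at this
  have hWR : W * (1 - R) = C (w 0) * A := by
    refine mul_right_cancel₀ h1X ?_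
    linear_combination hpk' - W * hRA
  have vW := hasVal_mk_one_of_nonneg hw0 hw
  have vA := hasVal_mk_one_of_nonneg ha0 ha
  have vR := hasVal_mk_one_of_nonneg (fun n => hta_nonneg (n + 1)) hta_sum
  -- Evaluation at `1`, where `W` and `A` have value `1` and `R` has value `ρ`.
  have hw00 : w 0 = 1 - ρ := by
    have h1 := vW.mul ((hasVal_one 1).sub vR)
    rw [← hW, ← hR, hWR] at h1
    have := h1.unique ((hasVal_C (w 0) 1).mul vA)
    linarith
  have hta1 : ta 1 < 1 := (le_hasSum hta_sum 0 fun n _ => hta_nonneg (n + 1)).trans_lt hρ1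
  have hR0 : constantCoeff (1 - R) ≠ 0 := by
    rw [map_sub, hR, constantCoeff_mk, map_one]
    exact (sub_pos.2 hta1).ne'
  have hR0' : (1 - R) ≠ 0 := fun h => hR0 (by rw [h, map_zero])
  obtain ⟨Q, hQR⟩ : ∃ Q, Q * (1 - R) = C (w 0) :=
    ⟨C (w 0) * (1 - R)⁻¹, by rw [mul_assoc, PowerSeries.inv_mul_cancel _ hR0, mul_one]⟩
  have hWQ : W = Q * A := by
    refine mul_right_cancel₀ hR0' ?_
    linear_combination hWR - A * hQR
  have hQ0 : ∀ n, 0 ≤ coeff n Q := coeff_nonneg_of_renewal (R := R) (hw0 0)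
    (fun n => by rw [hR, coeff_mk]; exact hta_nonneg _) (by rw [hR, coeff_mk]; exact hta1)
    (by linear_combination hQR)
  have ha00 : 0 < a 0 := by have := hta 0; rw [zero_add] at this; linarith
  -- In `W = Q * A` all coefficients are nonnegative, so `Qₙ * a 0 ≤ w n`; hence `Q` is summable,
  -- and its mass is `1` because `W` and `A` have mass `1`.
  have hQw : ∀ n, coeff n Q ≤ w n / a 0 := fun n => by
    rw [le_div_iff₀ ha00]
    have h := congrArg (coeff n) hWQ
    rw [coeff_mul, hW, coeff_mk] at h
    rw [h]
    have hmem : (n, (0 : ℕ)) ∈ Finset.HasAntidiagonal.antidiagonal n := by simp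
    have := Finset.single_le_sum (f := fun p : ℕ × ℕ => coeff p.1 Q * coeff p.2 A)
      (fun p _ => mul_nonneg (hQ0 _) (by rw [hA, coeff_mk]; exact ha0 _)) hmem
    simpa [hA] using this
  have vQ : Q.HasVal 1 1 := by
    have hsum : Summable fun n => coeff n Q :=
      Summable.of_nonneg_of_le hQ0 hQw (hw.summable.div_const _)
    have vQ : Q.HasVal 1 (∑' n, coeff n Q) :=
      ⟨by simpa using hsum.norm, by simpa using hsum.hasSum⟩
    have h1 := vQ.mul vA
    rw [← hA, ← hWQ] at h1
    have := h1.unique vW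
    rw [mul_one] at this
    rwa [this] at vQ
  -- The discrete NBUE property `htb_le` is used only here.
  have hD0 : ∀ n, 0 ≤ ta (n + 1) - tb (n + 1) / ρ := fun n => by
    rw [sub_nonneg, div_le_iff₀ hρ0, mul_comm]
    exact htb_le (n + 1)
  have vD := hasVal_mk_one_of_nonneg hD0 (hta_sum.sub (htb_sum.div_const ρ))
  have hG0 : ∀ n, 0 ≤ (1 - ρ) * ρ ^ n := fun n =>
    mul_nonneg (by linarith) (pow_nonneg hρ0.le n)
  have vG : G.HasVal 1 1 := by
    refine hasVal_mk_one_of_nonneg hG0 ?_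
    have := (hasSum_geometric_of_lt_one hρ0.le hρ1).mul_left (1 - ρ)
    rwa [mul_inv_cancel₀ (by linarith)] at this
  have hX0 : ∀ n, 0 ≤ coeff n (X : PowerSeries ℝ) := fun n => by
    rw [coeff_X]; split_ifs <;> simp
  have hXQD0 : ∀ n, 0 ≤ coeff n (X * (Q * D)) := coeff_mul_nonneg hX0
    (coeff_mul_nonneg hQ0 fun n => by rw [hD, coeff_mk]; exact hD0 n)
  have vU := (hasVal_X 1).mul (vQ.mul vD)
  have vV := ((hasVal_X 1).mul vG).mul vU
  simp only [one_mul] at vU vV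
  refine ⟨fun n => coeff n (X * (Q * D)), fun n => coeff n (X * G * (X * (Q * D))), hXQD0,
    coeff_mul_nonneg (coeff_mul_nonneg hX0 fun n => by rw [hG, coeff_mk]; exact hG0 n) hXQD0,
    vU.hasSum_coeff, vV.hasSum_coeff, fun n => ?_⟩
  have hC1 : (C (1 - ρ) : PowerSeries ℝ) = 1 - C ρ := by rw [map_sub, map_one]
  rw [hw00, hC1] at hQR
  rw [hC1] at hG1
  -- Multiplied by `1 - ρX`, the left side becomes `ρ X Q (B - A) = ρ X Q D (1 - X)`, while `(1 - X
  -- G)(1 - ρX) = 1 - X`.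
  have key : W - G = C ρ * (X * (Q * D) - X * G * (X * (Q * D))) := by
    refine mul_right_cancel₀ hρX ?_
    rw [hRB] at hRA hQR
    linear_combination (1 - C ρ * X) * hWQ - hG1 + C ρ * X ^ 2 * Q * D * hG1
      + hQR + C ρ * X * Q * hBA + Q * hRA
  have := congrArg (coeff n) key
  rw [map_sub, coeff_C_mul, map_sub, hW, hG, coeff_mk, coeff_mk] at this
  exact this

/-! ### Total variation from a signed decomposition -/

lemma hasSum_measureReal_singleton_mul {μ : Measure ℕ} [IsFiniteMeasure μ] {f : ℕ → ℝ}
    (hf : ∀ n, |f n| ≤ 1) : HasSum (fun n => μ.real {n} * f n) (∫ n, f n ∂μ) := by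
  have hs : Summable fun n => μ.real {n} :=
    summable_measure_toReal (fun n => measurableSet_singleton n)
      (fun i j hij => by simpa using hij)
  have hfi : Integrable f μ :=
    Integrable.of_bound (measurable_from_nat (f := f)).aestronglyMeasurable 1
      (ae_of_all _ fun n => hf n)
  have := integral_countable hfi
  simp only [smul_eq_mul] at this
  rw [this]
  refine (Summable.of_norm_bounded hs fun n => ?_).hasSum
  rw [norm_mul, Real.norm_of_nonneg measureReal_nonneg]
  exact mul_le_of_le_one_right measureReal_nonneg (hf n)

lemma hasSum_indicator_measureReal {μ : Measure ℕ} [IsFiniteMeasure μ] (A : Set ℕ) :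
    HasSum (A.indicator fun n => μ.real {n}) (μ.real A) := by
  have h := hasSum_measureReal_singleton_mul (μ := μ) (f := A.indicator 1) fun n => by
    by_cases h : n ∈ A <;> simp [h]
  rw [integral_indicator_one MeasurableSet.of_discrete] at h
  refine h.congr_fun fun n => ?_
  by_cases hn : n ∈ A <;> simp [hn]

/-- Two laws whose difference is that of two measures of mass `δ`, multiplied by `c`, have total
variation distance at most `c δ`. -/
lemma tvDist_le_of_sub_eq {μ ν : Measure ℕ} [IsFiniteMeasure μ] [IsFiniteMeasure ν] {U V : ℕ → ℝ}
    {c δ : ℝ} (hc : 0 ≤ c) (hU0 : ∀ n, 0 ≤ U n) (hV0 : ∀ n, 0 ≤ V n) (hU : HasSum U δ)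
    (hV : HasSum V δ) (h : ∀ n, μ.real {n} - ν.real {n} = c * (U n - V n)) :
    tvDist μ ν ≤ c * δ := by
  have hind : ∀ (A : Set ℕ) {F : ℕ → ℝ}, (∀ n, 0 ≤ F n) → HasSum F δ →
      ∃ u, HasSum (A.indicator F) u ∧ 0 ≤ u ∧ u ≤ δ := fun A F hF0 hF => by
    have hs := (hF.summable.indicator A).hasSum
    exact ⟨_, hs, hs.nonneg fun n => Set.indicator_nonneg (fun n _ => hF0 n) n,
      hasSum_le (fun n => Set.indicator_le_self' (fun n _ => hF0 n) n) hs hF⟩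
  refine ciSup_le fun A => ?_
  obtain ⟨u, hu, hu0, hu1⟩ := hind A hU0 hU
  obtain ⟨v, hv, hv0, hv1⟩ := hind A hV0 hV
  have h1 := (hasSum_indicator_measureReal (μ := μ) A).sub
    (hasSum_indicator_measureReal (μ := ν) A)
  have h2 := (hu.sub hv).mul_left c
  -- Both `u` and `v` lie in `[0, δ]`, so their difference is at most `δ` in absolute value, without
  -- a factor `2`.
  have h3 : μ.real A - ν.real A = c * (u - v) := by
    refine h1.unique (h2.congr_fun fun n => ?_)
    by_cases hn : n ∈ A
    · simp [hn, h]
    · simp [hn]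
  rw [h3, abs_mul, abs_of_nonneg hc]
  gcongr
  rw [abs_le]
  constructor <;> linarith

/-! ### Rescaling the service time -/

section Scaling

variable {Ω : Type*} [MeasurableSpace Ω] {P : Measure Ω} [IsProbabilityMeasure P] {S : Ω → ℝ}

/-- The law of a multiple of an NBUE variable is new better than used in expectation. -/
lemma IsNBUE.integral_max_map_le (hN : IsNBUE P S) (hS : Integrable S P) {c : ℝ} (hc : 0 < c)
    {y : ℝ} (hy : 0 ≤ y) :
    ∫ x, max (x - y) 0 ∂(P.map fun ω => c * S ω)
      ≤ (c * ∫ ω, S ω ∂P) * (P.map fun ω => c * S ω).real (Set.Ici y) := by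
  have hm : AEMeasurable (fun ω => c * S ω) P := hS.aemeasurable.const_mul c
  rw [integral_map hm (by fun_prop), measureReal_def,
    Measure.map_apply_of_aemeasurable hm measurableSet_Ici, ← measureReal_def]
  have h := mul_le_mul_of_nonneg_left (hN.integral_max_sub_le hS (div_nonneg hy hc.le)) hc.le
  rw [← integral_const_mul, ← mul_assoc] at h
  convert! h using 1
  · refine integral_congr_ae (ae_of_all _ fun ω => ?_)
    simp only
    rw [mul_max_of_nonneg _ _ hc.le, mul_zero, mul_sub, mul_div_cancel₀ _ hc.ne']
  · congr 2
    ext ω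
    simp only [Set.mem_preimage, Set.mem_Ici]
    exact (div_le_iff₀' hc).symm

end Scaling

end

/-! ### The total variation bound -/

theorem mainTheorem6 {Ω : Type*} [MeasurableSpace Ω] (P : Measure Ω) [IsProbabilityMeasure P]
    (lam : ℝ) (hlam : 0 < lam)
    (S : Ω → ℝ) (hS_nonneg : ∀ᵐ ω ∂P, 0 ≤ S ω) (hS_int : Integrable S P)
    (hS_pos : 0 < ∫ ω, S ω ∂P)
    (ρ : ℝ) (hρ_def : ρ = lam * ∫ ω, S ω ∂P) (hρ : ρ < 1)
    (T V : ℕ → Ω → ℝ) (N₀ : Ω → ℕ) (R₀ : Ω → ℝ)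
    (hqueue : IsMG1Queue P lam S T V N₀ R₀) (heq : InEquilibrium P T V N₀ R₀)
    (hNBUE : IsNBUE P S)
    (t : ℝ) (ht : 0 ≤ t) (W : Ω → ℕ) (hW : W = queueLength T V N₀ R₀ t)
    (p : unitInterval) (hp : (p : ℝ) = 1 - ρ) :
    Integrable (fun ω => S ω ^ 2) P ∧
      tvDist (P.map W) (geometricMeasure p) ≤
        ρ ^ 2 * (1 - (∫ ω, S ω ^ 2 ∂P) / (2 * (∫ ω, S ω ∂P) ^ 2)) := by
  have hρ0 : 0 < ρ := hρ_def ▸ mul_pos hlam hS_pos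
  have hm : AEMeasurable (fun ω => lam * S ω) P := hS_int.aemeasurable.const_mul lam
  -- Given the service time, the number of arrivals during it is Poisson with mean `lam * S`; mixing
  -- over `ν` gives its law.
  set ν := P.map fun ω => lam * S ω with hν_def
  have hνprob : IsProbabilityMeasure ν := Measure.isProbabilityMeasure_map hm
  have hν0 : ∀ᵐ x ∂ν, 0 ≤ x := by
    rw [hν_def, ae_map_iff hm measurableSet_Ici]
    exact hS_nonneg.mono fun ω hω => mul_nonneg hlam.le hω
  have hνi : Integrable (fun x => x) ν :=
    (integrable_map_measure (by fun_prop) hm).2 (hS_int.const_mul lam)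
  have hνm : ∫ x, x ∂ν = ρ := by
    rw [hν_def, integral_map hm (by fun_prop), integral_const_mul, hρ_def]
  have hν : ∀ y, 0 ≤ y → ∫ x, max (x - y) 0 ∂ν ≤ ρ * ν.real (Set.Ici y) := fun y hy => by
    rw [hρ_def]; exact hNBUE.integral_max_map_le hS_int hlam hy
  have hνsq := integrable_sq_of_nbue hρ0.le hν0 hνi hν
  have hSsq : Integrable (fun ω => S ω ^ 2) P := by
    have h := ((integrable_map_measure (by fun_prop) hm).1 hνsq).const_mul (lam ^ 2)⁻¹
    refine h.congr (ae_of_all _ fun ω => ?_)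
    simp only [Function.comp_apply]
    field_simp
  refine ⟨hSsq, ?_⟩
  have hσ : ∫ x, x ^ 2 ∂ν = lam ^ 2 * ∫ ω, S ω ^ 2 ∂P := by
    rw [hν_def, integral_map hm (by fun_prop), ← integral_const_mul]
    simp only [mul_pow]
  have hlaw : P.map W = P.map N₀ := by
    rw [hW]
    exact ((heq t ht).comp measurable_fst).map_eq
  have hN0m : AEMeasurable N₀ P := hqueue.measurable_number.aemeasurable
  have hNprob : IsProbabilityMeasure (P.map N₀) := Measure.isProbabilityMeasure_map hN0m
  have hwsum : HasSum (fun n => (P.map N₀).real {n}) 1 := by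
    simpa using hasSum_indicator_measureReal (μ := P.map N₀) Set.univ
  have hw0 : ∫ ω, (if N₀ ω = 0 then 1 else 0 : ℝ) ∂P = (P.map N₀).real {0} := by
    rw [map_measureReal_apply hqueue.measurable_number (measurableSet_singleton 0),
      ← integral_indicator_one (hqueue.measurable_number (measurableSet_singleton 0))]
    refine integral_congr_ae (ae_of_all _ fun ω => ?_)
    simp [Set.indicator]
  obtain ⟨U, V', hU0, hV0, hU, hV, hUV⟩ := sub_geometric_of_pollaczek_khinchine hρ0 hρ
    (w := fun n => (P.map N₀).real {n}) (fun _ => measureReal_nonneg) hwsum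
    (fun n => integral_nonneg_of_ae (hν0.mono fun x hx => poissonMass_nonneg n hx))
    (hasSum_integral_poissonMass hν0) (ta := fun n => ∫ x, poissonTail n x ∂ν)
    (by simp [poissonTail]) (integral_poissonTail_succ hν0)
    (fun n => integral_nonneg_of_ae (hν0.mono fun x hx => (poissonTail_mem n hx).1))
    (hνm ▸ hasSum_integral_poissonTail hν0 hνi) (tb := fun n => ∫ x, poissonTail₂ n x ∂ν)
    (by simpa [poissonTail₂] using hνm) (integral_poissonTail₂_succ hν0 hνi)
    (integral_poissonTail₂_le hνm.symm hρ0.le hν0 hνi hν)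
    (hasSum_integral_poissonTail₂ hν0 hνsq) (fun z hz0 hz1 => by
      refine ⟨_, _, hasSum_integral_poissonMass_mul_pow hν0 hz0.le hz1.le,
        hasSum_measureReal_singleton_mul (f := fun n => z ^ n) (fun n => ?_), ?_⟩
      · rw [abs_of_nonneg (pow_nonneg hz0.le n)]
        exact pow_le_one₀ hz0.le hz1.le
      · have h := hqueue.pollaczek_khinchine heq hlam hS_nonneg hS_int hS_pos (hρ_def ▸ hρ)
          hNBUE hz0 hz1
        have hs : ∫ x, Real.exp (-((1 - z) * x)) ∂ν
            = ∫ ω, Real.exp (-(lam * (1 - z) * S ω)) ∂P := by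
          rw [hν_def, integral_map hm (by fun_prop)]
          refine integral_congr_ae (ae_of_all _ fun ω => ?_)
          simp only
          ring_nf
        rw [integral_map hN0m (measurable_from_nat (f := fun n => z ^ n)).aestronglyMeasurable,
          hs, h, hw0])
  have hp0 : p ≠ 0 := fun h => by
    rw [h] at hp
    simp only [Set.Icc.coe_zero] at hp
    linarith
  have hbound := tvDist_le_of_sub_eq (μ := P.map N₀) (ν := geometricMeasure p) hρ0.le hU0 hV0 hU hV
    (fun n => by
      rw [geometricMeasure_real_singleton hp0, hp, ← hUV n]
      ring)
  rw [hlaw]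
  refine hbound.trans_eq ?_
  -- Here the bound is `ρ * (ρ - σ / ρ) = ρ ^ 2 - σ`, where `σ = lam ^ 2 * E S² / 2`.
  rw [hσ, hρ_def]
  field_simp
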